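/- **Setting.** In a congestion game on integral polymatroids there are a non-empty finite set $N$ of players and a non-empty finite set $R$ of resources; put $n=|N|$, $m=|R|$. Each player $i$ has a function $f^{(i)}:2^R\to\mathbb N$ that is submodular, monotone and satisfies $f^{(i)}(\emptyset)=0$, a demand $d_i\in\mathbb N$ with $1\le d_i\le f^{(i)}(R)$, and cost functions $c_{i,r}:\mathbb N\to\mathbb N$ ($r\in R$). Each $c_{i,r}$ is nondecreasing and $u$-truncated strongly semi-convex for $u=f^{(i)}(\{r\})$, i.e. $c(a+x)x-c(a+x-1)(x-1)\le c(b+y)y-c(b+y-1)(y-1)$ for all integers $1\le x\le y\le u$ and $0\le a\le b$. For $e\in\mathbb N$ let $X_i(e)=\{x\in\mathbb N^R:\sum_{r\in U}x_r\le f^{(i)}(U)\ \forall U\subseteq R,\ \sum_{r\in R}x_r=e\}$. The strategies of player $i$ are the elements of $X_i(d_i)$, and the private cost in a profile $x$ is $\pi_i(x)=\sum_{r\in R}c_{i,r}(x_r)\,x_{i,r}$ with $x_r=\sum_{j\in N}x_{j,r}$. A best response of $i$ minimizes $\pi_i$ over the strategies of $i$, with the strategies of the others fixed; a pure Nash equilibrium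 is a profile of strategies in which everybody plays a best response. Let $\delta=\max_i d_i$ and $H(x,y)=\sum_{r}|x_r-y_r|$. **Algorithm 1.** Start with $\bar d_i=0$ and $x_i=0$ for all $i$. For $k=1,\dots,\sum_i d_i$: choose some $i$ with $\bar d_i<d_i$, increase $\bar d_i$ by one, choose a best response $y_i\in X_i(\bar d_i)$ with $H(y_i,x_i)=1$ and set $x_i\leftarrow y_i$; then, while some player can improve in the game with the demands $\bar d$, take such a player $i$, choose a best response $y_i\in X_i(\bar d_i)$ with $H(y_i,x_i)=2$ and set $x_i\leftarrow y_i$. Return $x$. **Corollary.** (a) Whatever choices it makes, Algorithm 1 runs for at most $n^{\delta+1}m^{\delta}\delta^{\delta+1}$ iterations, where the iterations of the for-loop and those of the while-loop are all counted; it never gets stuck (the required best responses always exist), and the profile that it returns is a pure Nash equilibrium. (b) Hence a pure Nash equilibrium can be computed in polynomial time when $\delta$ is constant: there is one random access machine program that uses value oracles for the $f^{(i)}$ and the $c_{i,r}$ and whose time is measured at logarithmic cost, such that for every constant $\delta$ there is a polynomial $P$ with the following property. For every congestion game on integral polymatroids with players $0,\dots,n-1$, resources $0,\dots,m-1$ ($n,m\ge1$)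 and all demands at most $\delta$, the program, given $n$, $m$ and the demands, halts after time at most $P(n+m+\beta)$ and outputs a pure Nash equilibrium. Here $\beta$ is the largest bit length of the values $f^{(i)}(U)$ ($i\in N$, $U\subseteq R$) and $c_{i,r}(x)$ ($i\in N$, $r\in R$, $0\le x\le\sum_j d_j$). -/

import Mathlib

/-- An integral polymatroid rank function on the finite set `R` of resources. -/
structure PolymatroidRank (R : Type*) [DecidableEq R] where
  rank : Finset R → ℕ
  normalized : rank ∅ = 0
  monotone : ∀ U V : Finset R, U ⊆ V → rank U ≤ rank V
  submodular : ∀ U V : Finset R, rank (U ∪ V) + rank (U ∩ V) ≤ rank U + rank V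

/-- The integral polymatroid base polyhedron of `f` with demand `d`. -/
def PolymatroidRank.base {R : Type*} [Fintype R] [DecidableEq R]
    (f : PolymatroidRank R) (d : ℕ) : Set (R → ℕ) :=
  {x | (∀ U : Finset R, ∑ r ∈ U, x r ≤ f.rank U) ∧ ∑ r, x r = d}

/-- `c` is `u`-truncated strongly semi-convex. The inequality is read in `ℤ`; the inner natural
subtractions are exact because `1 ≤ x` and `1 ≤ y`. The condition is void for `u = 0`. -/
def TruncStronglySemiConvex (u : ℕ) (c : ℕ → ℕ) : Prop :=
  ∀ x y a b : ℕ, 1 ≤ x → x ≤ y → y ≤ u → a ≤ b →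
    (c (a + x) * x : ℤ) - c (a + x - 1) * (x - 1) ≤
      (c (b + y) * y : ℤ) - c (b + y - 1) * (y - 1)

/-- A congestion game on integral polymatroids with players `N` and resources `R`, with
player-specific costs that are nondecreasing and truncated strongly semi-convex. -/
structure PolymatroidGame (N R : Type*) [Fintype R] [DecidableEq R] where
  demand : N → ℕ
  f : N → PolymatroidRank R
  c : N → R → ℕ → ℕ
  demand_pos : ∀ i, 1 ≤ demand i
  demand_le : ∀ i, demand i ≤ (f i).rank Finset.univ
  cost_mono : ∀ i r, Monotone (c i r)
  cost_ssc : ∀ i r, TruncStronglySemiConvex ((f i).rank {r}) (c i r)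

namespace PolymatroidGame

section Game

variable {N R : Type*} [Fintype N] [DecidableEq N] [Fintype R] [DecidableEq R]

/-- The private cost `∑ r, c i r (x_r) * x i r`, where `x_r = ∑ j, x j r`. -/
def privateCost (G : PolymatroidGame N R) (x : N → R → ℕ) (i : N) : ℕ :=
  ∑ r, G.c i r (∑ j, x j r) * x i r

/-- In the game with demands `e`, the strategy `y` is a best response of player `i` to the
strategies of the other players in `x`. -/
def IsBestResponse (G : PolymatroidGame N R) (e : N → ℕ) (x : N → R → ℕ) (i : N)
    (y : R → ℕ) : Prop :=
  y ∈ (G.f i).base (e i) ∧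
    ∀ z ∈ (G.f i).base (e i),
      G.privateCost (Function.update x i y) i ≤ G.privateCost (Function.update x i z) i

/-- In the game with demands `e`, player `i` can strictly improve on the profile `x`. -/
def CanImprove (G : PolymatroidGame N R) (e : N → ℕ) (x : N → R → ℕ) (i : N) : Prop :=
  ∃ y ∈ (G.f i).base (e i), G.privateCost (Function.update x i y) i < G.privateCost x i

/-- `x` is a pure Nash equilibrium of `G`. -/
def IsPureNash (G : PolymatroidGame N R) (x : N → R → ℕ) : Prop :=
  ∀ i, G.IsBestResponse G.demand x i (x i)

/-- The distance `∑ r, |x r - y r|`. -/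
def hamming (x y : R → ℕ) : ℕ := ∑ r, ((x r : ℤ) - (y r : ℤ)).natAbs

/-- The variables of the algorithm: the number `k` of iterations of the for-loop started so far,
the preliminary demands and the preliminary strategies. -/
structure AlgState (N R : Type*) where
  k : ℕ
  demand : N → ℕ
  profile : N → R → ℕ

/-- All variables are set to zero. -/
def AlgState.init (N R : Type*) : AlgState N R := ⟨0, fun _ => 0, fun _ _ => 0⟩

/-- One iteration of the algorithm. All choices are free.
`forStep`: the while-loop is not entered (again), so the next iteration of the for-loop starts:
some player `i` whose preliminary demand is below the demand gets one more unit of demand and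
moves to a best response at distance one.
`whileStep`: one iteration of the while-loop: some player `i` who can improve in the game with
the preliminary demands moves to a best response at distance two. -/
inductive AlgStep (G : PolymatroidGame N R) : AlgState N R → AlgState N R → Prop
  | forStep (s : AlgState N R) (i : N) (y : R → ℕ)
      (hk : s.k < ∑ j, G.demand j)
      (hexit : ¬ ∃ j, G.CanImprove s.demand s.profile j)
      (hi : s.demand i < G.demand i)
      (hy : G.IsBestResponse (Function.update s.demand i (s.demand i + 1)) s.profile i y)
      (hd : hamming y (s.profile i) = 1) :
      AlgStep G s ⟨s.k + 1, Function.update s.demand i (s.demand i + 1),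
        Function.update s.profile i y⟩
  | whileStep (s : AlgState N R) (i : N) (y : R → ℕ)
      (hi : G.CanImprove s.demand s.profile i)
      (hy : G.IsBestResponse s.demand s.profile i y)
      (hd : hamming y (s.profile i) = 2) :
      AlgStep G s ⟨s.k, s.demand, Function.update s.profile i y⟩

/-- `G.AlgRun T s`: the algorithm can be in state `s` after exactly `T` iterations, where the
iterations of the for-loop and those of the while-loop are all counted. -/
inductive AlgRun (G : PolymatroidGame N R) : ℕ → AlgState N R → Prop
  | start : AlgRun G 0 (AlgState.init N R)
  | step {T : ℕ} {s s' : AlgState N R} (h : AlgRun G T s) (h' : AlgStep G s s') :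
      AlgRun G (T + 1) s'

/-- The algorithm returns in state `s`: the for-loop is exhausted and the while-loop is left. -/
def AlgReturns (G : PolymatroidGame N R) (s : AlgState N R) : Prop :=
  s.k = ∑ j, G.demand j ∧ ¬ ∃ j, G.CanImprove s.demand s.profile j

/-- The maximum demand. -/
def maxDemand (G : PolymatroidGame N R) : ℕ := Finset.univ.sup G.demand

/-- The largest bit length of a value of a rank function, or of a value of a cost function at a
load that is at most the total demand. -/
def maxBits (G : PolymatroidGame N R) : ℕ :=
  (Finset.univ.sup fun i => Finset.univ.sup fun U : Finset R => Nat.size ((G.f i).rank U)) ⊔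
    (Finset.univ.sup fun i => Finset.univ.sup fun r =>
      (Finset.range (∑ j, G.demand j + 1)).sup fun x => Nat.size (G.c i r x))

end Game

end PolymatroidGame

/-! ### Random access machines with value oracles, at logarithmic cost

The memory consists of arrays of natural numbers. A program names finitely many of them, and it
computes addresses inside an array. -/

/-- `μ a j` is the entry of array `a` at address `j`. -/
abbrev RamMem := ℕ → ℕ → ℕ

/-- The memory after `a[j] := v`. -/
def RamMem.write (μ : RamMem) (a j v : ℕ) : RamMem :=
  Function.update μ a (Function.update (μ a) j v)

/-- Expressions: literals, array access, arithmetic (with truncated subtraction), and the two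
oracle queries: `rank i a` asks for the rank function of player `i` at the set of those resources
whose entry in array `a` is nonzero, and `cost i r x` for the cost function of player `i` on
resource `r` at load `x`. -/
inductive RamExpr : Type
  | lit (v : ℕ)
  | get (a : ℕ) (j : RamExpr)
  | add (e₁ e₂ : RamExpr)
  | sub (e₁ e₂ : RamExpr)
  | mul (e₁ e₂ : RamExpr)
  | rank (i : RamExpr) (a : ℕ)
  | cost (i r x : RamExpr)

/-- Programs. A condition counts as true when its value is nonzero. -/
inductive RamProg : Type
  | skip
  | assign (a : ℕ) (j e : RamExpr)
  | seq (p q : RamProg)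
  | ite (e : RamExpr) (p q : RamProg)
  | loop (e : RamExpr) (p : RamProg)

section Ram

variable {n m : ℕ}

/-- The answer to a rank query; it is `0` for a player that does not exist. -/
def rankOracle (G : PolymatroidGame (Fin n) (Fin m)) (i : ℕ) (A : ℕ → ℕ) : ℕ :=
  if h : i < n then (G.f ⟨i, h⟩).rank (Finset.univ.filter fun r : Fin m => A r ≠ 0) else 0

/-- The answer to a cost query; it is `0` for a player or a resource that does not exist. -/
def costOracle (G : PolymatroidGame (Fin n) (Fin m)) (i r x : ℕ) : ℕ :=
  if h : i < n ∧ r < m then G.c ⟨i, h.1⟩ ⟨r, h.2⟩ x else 0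

/-- The value of an expression. -/
def RamExpr.val (G : PolymatroidGame (Fin n) (Fin m)) (μ : RamMem) : RamExpr → ℕ
  | .lit v => v
  | .get a j => μ a (j.val G μ)
  | .add e₁ e₂ => e₁.val G μ + e₂.val G μ
  | .sub e₁ e₂ => e₁.val G μ - e₂.val G μ
  | .mul e₁ e₂ => e₁.val G μ * e₂.val G μ
  | .rank i a => rankOracle G (i.val G μ) (μ a)
  | .cost i r x => costOracle G (i.val G μ) (r.val G μ) (x.val G μ)

/-- The time for evaluating an expression: every operation costs one plus the bit length of its
result, in addition to the time for its arguments, and a rank query costs `m` more, the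
length of the description of the set. -/
def RamExpr.time (G : PolymatroidGame (Fin n) (Fin m)) (μ : RamMem) : RamExpr → ℕ
  | .lit v => 1 + Nat.size v
  | .get a j => j.time G μ + 1 + Nat.size (RamExpr.val G μ (.get a j))
  | .add e₁ e₂ => e₁.time G μ + e₂.time G μ + 1 + Nat.size (RamExpr.val G μ (.add e₁ e₂))
  | .sub e₁ e₂ => e₁.time G μ + e₂.time G μ + 1 + Nat.size (RamExpr.val G μ (.sub e₁ e₂))
  | .mul e₁ e₂ => e₁.time G μ + e₂.time G μ + 1 + Nat.size (RamExpr.val G μ (.mul e₁ e₂))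
  | .rank i a => i.time G μ + m + 1 + Nat.size (RamExpr.val G μ (.rank i a))
  | .cost i r x =>
      i.time G μ + r.time G μ + x.time G μ + 1 + Nat.size (RamExpr.val G μ (.cost i r x))

/-- `RamExec G p μ t μ'`: with the oracles of `G`, the program `p` started in memory `μ` halts
after time `t` in memory `μ'`. -/
inductive RamExec (G : PolymatroidGame (Fin n) (Fin m)) :
    RamProg → RamMem → ℕ → RamMem → Prop
  | skip (μ : RamMem) : RamExec G .skip μ 1 μ
  | assign (μ : RamMem) (a : ℕ) (j e : RamExpr) :
      RamExec G (.assign a j e) μ (j.time G μ + e.time G μ + 1)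
        (μ.write a (j.val G μ) (e.val G μ))
  | seq {p q : RamProg} {μ μ' μ'' : RamMem} {t t' : ℕ}
      (h : RamExec G p μ t μ') (h' : RamExec G q μ' t' μ'') :
      RamExec G (.seq p q) μ (t + t' + 1) μ''
  | ite_true {e : RamExpr} {p q : RamProg} {μ μ' : RamMem} {t : ℕ}
      (he : e.val G μ ≠ 0) (h : RamExec G p μ t μ') :
      RamExec G (.ite e p q) μ (e.time G μ + t + 1) μ'
  | ite_false {e : RamExpr} {p q : RamProg} {μ μ' : RamMem} {t : ℕ}
      (he : e.val G μ = 0) (h : RamExec G q μ t μ') :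
      RamExec G (.ite e p q) μ (e.time G μ + t + 1) μ'
  | loop_true {e : RamExpr} {p : RamProg} {μ μ' μ'' : RamMem} {t t' : ℕ}
      (he : e.val G μ ≠ 0) (h : RamExec G p μ t μ') (h' : RamExec G (.loop e p) μ' t' μ'') :
      RamExec G (.loop e p) μ (e.time G μ + t + t' + 1) μ''
  | loop_false {e : RamExpr} {p : RamProg} {μ : RamMem}
      (he : e.val G μ = 0) :
      RamExec G (.loop e p) μ (e.time G μ + 1) μ

/-- The input: array `0` starts with `n` and `m`, array `1` starts with the demands, and all other
entries are `0`. The rank and cost functions are given by the oracles. -/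
def ramInput (G : PolymatroidGame (Fin n) (Fin m)) : RamMem := fun a j =>
  if a = 0 then (if j = 0 then n else if j = 1 then m else 0)
  else if a = 1 then (if h : j < n then G.demand ⟨j, h⟩ else 0)
  else 0

/-- The output: array `2` holds the strategies, row by row. -/
def ramOutput (n m : ℕ) (μ : RamMem) : Fin n → Fin m → ℕ := fun i r => μ 2 (i * m + r)

end Ram

/-! With the strategies of the others fixed, a player's cost is a separable function on the bases of
an integral polymatroid, and semi-convexity makes its increments `inc` nondecreasing. By the
simultaneous exchange property (`exchange`), a base that no exchange of a single unit improves is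
then globally optimal (`LocallyOptimal.le_sum`). Best responses thus become inequalities between
increments (`isBestResponse_iff`).

The invariant of the algorithm is a marked resource `r` (`Marked`): every player would be at a best
response if one unit of the others on `r` were discounted. Inserting a unit at an equilibrium marks
the resource that receives it. An improving exchange must take a unit off the marked resource
(`Marked.eq_of_lt`), and moving this unit to where it is cheapest is already a best response
(`OptAt.reinsert`). The target of the move becomes the new mark (`Marked.move`, resting on
`OptAt.subUnit_of_move`). Hence the required best responses exist.

Termination: the loads with the marked unit discounted are constant between two insertions
(`load_move_eq`). At these fixed loads every placed unit is charged the rank of its increment among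
the `m * δ` increments of its owner, and each move lowers the sum of the ranks (`potential_move`).
There are at most `n * δ` units, each with rank at most `m * δ - 1`, so a phase between two
insertions has at most `n * δ * (m * δ - 1) + 1` iterations. At most `n * δ` phases give `n ^ 2 * m
* δ ^ 3`, which is below the claimed bound.

For the machine, one particular resolution of the choices is programmed. Independence of a vector
with sum at most `d` only has to be tested on subsets of its support, and these are enumerated by `2
^ d` numbers (`indep_iff_selected`); this is where constant `δ` is used. The program stores no
products, so bit lengths grow by at most a constant per instruction, and a polynomial number of
instructions takes polynomial logarithmic-cost time (`RamRuns.exists_exec`). -/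

open PolymatroidRank

set_option linter.unusedSectionVars false

/-! ### Integral polymatroids: exchange, augmentation, local optimality -/

namespace PolymatroidRank

section

variable {R : Type*} [Fintype R] [DecidableEq R]

/-- The vector `z` with one more unit on `p`. -/
def addUnit {R : Type*} [DecidableEq R] (z : R → ℕ) (p : R) : R → ℕ :=
  fun r => z r + if r = p then 1 else 0

@[simp] theorem addUnit_self {R : Type*} [DecidableEq R] (z : R → ℕ) (p : R) :
    addUnit z p p = z p + 1 := by simp [addUnit]

theorem addUnit_of_ne {R : Type*} [DecidableEq R] (z : R → ℕ) {p r : R} (h : r ≠ p) :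
    addUnit z p r = z r := by simp [addUnit, h]

theorem addUnit_comm {R : Type*} [DecidableEq R] (z : R → ℕ) (p q : R) :
    addUnit (addUnit z p) q = addUnit (addUnit z q) p := by
  ext r
  simp only [addUnit]
  omega

theorem addUnit_injective {R : Type*} [DecidableEq R] {z w : R → ℕ} {p : R}
    (h : addUnit z p = addUnit w p) : z = w := by
  ext r
  simpa [addUnit] using congrFun h r

theorem sum_addUnit {R : Type*} [DecidableEq R] (z : R → ℕ) (p : R) (U : Finset R) :
    ∑ r ∈ U, addUnit z p r = ∑ r ∈ U, z r + if p ∈ U then 1 else 0 := by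
  simp [addUnit, Finset.sum_add_distrib]

theorem univ_sum_addUnit (z : R → ℕ) (p : R) :
    ∑ r, addUnit z p r = ∑ r, z r + 1 := by
  simp [sum_addUnit]

theorem exists_eq_addUnit {R : Type*} [DecidableEq R] {x : R → ℕ} {p : R} (h : 0 < x p) :
    ∃ z : R → ℕ, x = addUnit z p := by
  refine ⟨fun r => x r - if r = p then 1 else 0, ?_⟩
  ext r
  by_cases hr : r = p
  · subst hr; simp; omega
  · simp [addUnit, hr]

theorem le_rank_singleton {f : PolymatroidRank R} {d : ℕ} {x : R → ℕ} (hx : x ∈ f.base d)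
    (r : R) : x r ≤ f.rank {r} := by
  simpa using hx.1 {r}

theorem base_of_le {f : PolymatroidRank R} {d e : ℕ} {x z : R → ℕ} (hx : x ∈ f.base d)
    (hzx : z ≤ x) (hz : ∑ r, z r = e) : z ∈ f.base e :=
  ⟨fun U => (Finset.sum_le_sum fun r _ => hzx r).trans (hx.1 U), hz⟩

/-- Truncation of a rank function at `d`. -/
def truncate (f : PolymatroidRank R) (d : ℕ) : PolymatroidRank R where
  rank U := min (f.rank U) d
  normalized := by simp [f.normalized]
  monotone U V h := min_le_min_right _ (f.monotone U V h)
  submodular U V := by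
    have h1 := f.submodular U V
    have h2 := f.monotone U (U ∪ V) Finset.subset_union_left
    have h3 := f.monotone V (U ∪ V) Finset.subset_union_right
    have h4 := f.monotone (U ∩ V) U Finset.inter_subset_left
    have h5 := f.monotone (U ∩ V) V Finset.inter_subset_right
    omega

theorem base_truncate (f : PolymatroidRank R) (d : ℕ) : (f.truncate d).base d = f.base d := by
  ext x
  constructor
  · rintro ⟨h, h'⟩
    exact ⟨fun U => (h U).trans (min_le_left _ _), h'⟩
  · rintro ⟨h, h'⟩
    exact ⟨fun U => le_min (h U) (h' ▸ Finset.sum_le_sum_of_subset (Finset.subset_univ U)), h'⟩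

theorem tight_union_inter {R : Type*} [DecidableEq R] {f : PolymatroidRank R} {x : R → ℕ}
    (hx : ∀ U : Finset R, ∑ r ∈ U, x r ≤ f.rank U) {U V : Finset R}
    (hU : ∑ r ∈ U, x r = f.rank U) (hV : ∑ r ∈ V, x r = f.rank V) :
    ∑ r ∈ U ∪ V, x r = f.rank (U ∪ V) ∧ ∑ r ∈ U ∩ V, x r = f.rank (U ∩ V) := by
  have h1 := f.submodular U V
  have h2 := hx (U ∪ V)
  have h3 := hx (U ∩ V)
  have h4 := Finset.sum_union_inter (s₁ := U) (s₂ := V) (f := x)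
  omega

/-- The simultaneous exchange property of bases, for a rank function that is already truncated. -/
theorem exchange_of_rank_univ {f : PolymatroidRank R} {d : ℕ} (hd : f.rank Finset.univ = d)
    {z y : R → ℕ} {u : R} (hx : addUnit z u ∈ f.base d) (hy : y ∈ f.base d)
    (hu : y u ≤ z u) :
    ∃ v w, y = addUnit w v ∧ z v < y v ∧ addUnit z v ∈ f.base d ∧
      addUnit w u ∈ f.base d := by
  classical
  set x : R → ℕ := addUnit z u with hxdef
  -- `D` is a smallest `y`-tight set containing `u` (the ground set is one, by `hd`) and `T` a
  -- largest `x`-tight set avoiding `u`. Tight sets are closed under union and intersection. So in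
  -- `y` every `v ∈ D` with a unit to give can be traded for `u`, and in `x` the unit on `u` can be
  -- traded for any `v ∉ T` with `v ≠ u`.
  obtain ⟨D, hD, hDmin⟩ := Finset.exists_min_image
    (Finset.univ.filter fun U : Finset R => u ∈ U ∧ ∑ r ∈ U, y r = f.rank U) Finset.card
    ⟨Finset.univ, by simp [hy.2, hd]⟩
  obtain ⟨T, hT, hTmax⟩ := Finset.exists_max_image
    (Finset.univ.filter fun U : Finset R => u ∉ U ∧ ∑ r ∈ U, x r = f.rank U) Finset.card
    ⟨∅, by simp [f.normalized]⟩
  simp only [Finset.mem_filter, Finset.mem_univ, true_and] at hD hDmin hT hTmax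
  by_contra! hcon
  have key : ∀ v ∈ D, x v < y v → v ∈ T := by
    intro v hvD hv
    have hvu : v ≠ u := by
      rintro rfl
      simp [hxdef] at hv
      omega
    have hzv : z v < y v := by simpa [hxdef, addUnit, hvu] using hv
    obtain ⟨w, hw⟩ := exists_eq_addUnit (x := y) (p := v) (by omega)
    have hwu : addUnit w u ∈ f.base d := by
      refine ⟨fun U => ?_, ?_⟩
      · by_contra! hU
        have hyU := hy.1 U
        rw [sum_addUnit] at hU
        rw [hw, sum_addUnit] at hyU
        have huU : u ∈ U := by
          by_contra h
          simp [h] at hU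
          omega
        have hvU : v ∉ U := by
          intro h
          simp [h, huU] at hU hyU
          omega
        have hyt : ∑ r ∈ U, y r = f.rank U := by
          rw [hw, sum_addUnit]
          simp [huU, hvU] at hU hyU ⊢
          omega
        have h1 := (tight_union_inter hy.1 hD.2 hyt).2
        have h2 := hDmin (D ∩ U) ⟨by simp [hD.1, huU], h1⟩
        have h3 : D ∩ U ⊂ D := by
          refine Finset.ssubset_iff_subset_ne.2 ⟨Finset.inter_subset_left, fun h => hvU ?_⟩
          rw [← h] at hvD
          exact (Finset.mem_inter.1 hvD).2
        exact absurd (Finset.card_lt_card h3) (by omega)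
      · have := hy.2
        rw [hw, univ_sum_addUnit] at this
        rw [univ_sum_addUnit, this]
    by_contra hvT
    refine hcon v w hw hzv ⟨fun U => ?_, ?_⟩ hwu
    · by_contra! hU
      have hxU := hx.1 U
      rw [hxdef, sum_addUnit] at hxU
      rw [sum_addUnit] at hU
      have hvU : v ∈ U := by
        by_contra h
        simp [h] at hU
        omega
      have huU : u ∉ U := by
        intro h
        simp [h, hvU] at hU hxU
        omega
      have hxt : ∑ r ∈ U, x r = f.rank U := by
        rw [hxdef, sum_addUnit]
        simp [huU, hvU] at hU hxU ⊢
        omega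
      have h1 := (tight_union_inter hx.1 hT.2 hxt).1
      have h2 := hTmax (T ∪ U) ⟨by simp [hT.1, huU], h1⟩
      have h3 : T ⊂ T ∪ U := by
        refine Finset.ssubset_iff_subset_ne.2 ⟨Finset.subset_union_left, fun h => hvT ?_⟩
        rw [h]
        exact Finset.mem_union_right _ hvU
      exact absurd (Finset.card_lt_card h3) (by omega)
    · have := hx.2
      rw [hxdef, univ_sum_addUnit] at this
      rw [univ_sum_addUnit, this]
  -- Counting: `x(D ∪ T) + y(D ∩ T) ≤ f D + f T = y(D) + x(T)`, so `x(D \ T) ≤ y(D \ T)`. But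
  -- without a common `v`, `key` gives `y ≤ x` on `D \ T`, strictly at `u`.
  have h1 := f.submodular D T
  have h2 := hx.1 (D ∪ T)
  have h3 := hy.1 (D ∩ T)
  have h4 : ∑ r ∈ D ∪ T, x r = ∑ r ∈ D \ T, x r + ∑ r ∈ T, x r := by
    rw [← Finset.sum_union Finset.sdiff_disjoint, Finset.sdiff_union_self_eq_union]
  have h5 : ∑ r ∈ D, y r = ∑ r ∈ D ∩ T, y r + ∑ r ∈ D \ T, y r :=
    (Finset.sum_inter_add_sum_sdiff D T y).symm
  have h6 : ∑ r ∈ D \ T, y r < ∑ r ∈ D \ T, x r := by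
    refine Finset.sum_lt_sum (fun v hv => ?_) ⟨u, by simp [hD.1, hT.1], by simp [hxdef]; omega⟩
    by_contra! h
    exact (Finset.mem_sdiff.1 hv).2 (key v (Finset.mem_sdiff.1 hv).1 h)
  omega

/-- The simultaneous exchange property of bases. -/
theorem exchange {f : PolymatroidRank R} {d : ℕ} {z y : R → ℕ} {u : R}
    (hx : addUnit z u ∈ f.base d) (hy : y ∈ f.base d) (hu : y u ≤ z u) :
    ∃ v w, y = addUnit w v ∧ z v < y v ∧ addUnit z v ∈ f.base d ∧
      addUnit w u ∈ f.base d := by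
  -- Truncation keeps the bases and makes the ground set tight.
  have hd : (f.truncate d).rank Finset.univ = d := by
    have := hy.1 Finset.univ
    rw [hy.2] at this
    simpa [truncate] using this
  simpa only [base_truncate] using exchange_of_rank_univ (f := f.truncate d) hd
    (by rwa [base_truncate]) (by rwa [base_truncate]) hu

/-- A vector below the rank of the ground set can be augmented. -/
theorem exists_augment {f : PolymatroidRank R} {d : ℕ} {x : R → ℕ} (hx : x ∈ f.base d)
    (hd : d < f.rank Finset.univ) : ∃ r, addUnit x r ∈ f.base (d + 1) := by
  classical
  -- The largest tight set is proper because `d` is below the full rank. Any element outside can be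
  -- raised: a tight set containing it would enlarge `T`.
  obtain ⟨T, hT, hTmax⟩ := Finset.exists_max_image
    (Finset.univ.filter fun U : Finset R => ∑ r ∈ U, x r = f.rank U) Finset.card
    ⟨∅, by simp [f.normalized]⟩
  simp only [Finset.mem_filter, Finset.mem_univ, true_and] at hT hTmax
  have hTu : T ≠ Finset.univ := by
    rintro rfl
    rw [hx.2] at hT
    omega
  obtain ⟨v, hv⟩ : ∃ v, v ∉ T := by
    by_contra! h
    exact hTu (Finset.eq_univ_iff_forall.2 h)
  refine ⟨v, fun U => ?_, by rw [univ_sum_addUnit, hx.2]⟩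
  rw [sum_addUnit]
  have hU := hx.1 U
  split_ifs with hvU
  · by_contra! h
    have h2 := hTmax (T ∪ U) (tight_union_inter hx.1 hT (by omega)).1
    have h3 : T ⊂ T ∪ U := by
      refine Finset.ssubset_iff_subset_ne.2 ⟨Finset.subset_union_left, fun h => hv ?_⟩
      rw [h]
      exact Finset.mem_union_right _ hvU
    exact absurd (Finset.card_lt_card h3) (by omega)
  · simpa using hU

/-- `x` is a base, and no exchange of a single unit decreases a separable function with the
increments `φ`. -/
def LocallyOptimal (f : PolymatroidRank R) (d : ℕ) (φ : R → ℕ → ℤ) (x : R → ℕ) : Prop :=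
  x ∈ f.base d ∧ ∀ z p q, x = addUnit z p → addUnit z q ∈ f.base d →
    φ p (z p) ≤ φ q (z q)

theorem sum_comp_addUnit (C : R → ℕ → ℤ) (z : R → ℕ) (p : R) :
    ∑ r, C r ((addUnit z p) r) = ∑ r, C r (z r) + (C p (z p + 1) - C p (z p)) := by
  rw [← Finset.add_sum_erase _ _ (Finset.mem_univ p),
    ← Finset.add_sum_erase _ (fun r => C r (z r)) (Finset.mem_univ p),
    Finset.sum_congr rfl (g := fun r => C r (z r))]
  · rw [addUnit_self]
    ring
  · intro r hr
    rw [addUnit_of_ne _ (Finset.mem_erase.1 hr).1]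

/-- For separable convex functions, local optimality implies optimality. -/
theorem LocallyOptimal.le_sum {f : PolymatroidRank R} {d : ℕ} {C : R → ℕ → ℤ}
    (hC : ∀ r k l, k ≤ l → l + 1 ≤ f.rank {r} → C r (k + 1) - C r k ≤ C r (l + 1) - C r l)
    {x : R → ℕ} (hx : f.LocallyOptimal d (fun r k => C r (k + 1) - C r k) x)
    {y : R → ℕ} (hy : y ∈ f.base d) : ∑ r, C r (x r) ≤ ∑ r, C r (y r) := by
  -- The induction moves `y` towards `x`; when the excess is zero, `x ≤ y` with equal sums.
  induction hD : ∑ r, (x r - y r) generalizing y with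
  | zero =>
    have hle : ∀ r ∈ Finset.univ, x r ≤ y r := by
      intro r _
      have := (Finset.sum_eq_zero_iff.1 hD) r (Finset.mem_univ r)
      omega
    have heq := (Finset.sum_eq_sum_iff_of_le hle).1 (hx.1.2.trans hy.2.symm)
    exact le_of_eq (Finset.sum_congr rfl fun r hr => by rw [heq r hr])
  | succ D ih =>
    obtain ⟨u, -, hu⟩ : ∃ u ∈ Finset.univ, x u - y u ≠ 0 :=
      Finset.exists_ne_zero_of_sum_ne_zero (by omega)
    obtain ⟨z, hz⟩ := exists_eq_addUnit (x := x) (p := u) (by omega)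
    have hzu : x u = z u + 1 := by simp [hz]
    -- The exchange is feasible in both bases. Optimality of `x` compares `u` with `v` at the levels
    -- of `z`, and convexity transfers this to the levels of `w`, so trading `v` for `u` in `y` does
    -- not raise the cost.
    obtain ⟨v, w, hw, hzv, hbz, hbw⟩ := exchange (hz ▸ hx.1) hy (u := u) (by omega)
    have hvu : v ≠ u := by
      rintro rfl
      omega
    have hyv : y v = w v + 1 := by simp [hw]
    have hyu : y u = w u := by simp [hw, addUnit, hvu.symm]
    have h1 := hx.2 z u v hz hbz
    have h2 := hC u (w u) (z u) (by omega) (by have := le_rank_singleton hx.1 u; omega)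
    have h3 := hC v (z v) (w v) (by omega) (by have := le_rank_singleton hy v; omega)
    have h4 := ih hbw (by
      have h : ∑ r, (x r - y r) = ∑ r, (x r - (addUnit w u) r) + 1 := by
        rw [← Finset.add_sum_erase _ _ (Finset.mem_univ u),
          ← Finset.add_sum_erase _ (fun r => x r - (addUnit w u) r) (Finset.mem_univ u),
          Finset.sum_congr rfl (g := fun r => x r - (addUnit w u) r)]
        · simp
          omega
        · intro r hr
          have hru := (Finset.mem_erase.1 hr).1
          by_cases hrv : r = v
          · subst hrv
            have : x r = z r := by simp [hz, addUnit, hru]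
            rw [addUnit_of_ne _ hru]
            omega
          · simp [hw, addUnit, hru, hrv]
      omega)
    have h5 := sum_comp_addUnit C w u
    have h6 := sum_comp_addUnit C w v
    rw [← hw] at h6
    simp only at h1
    linarith

theorem locallyOptimal_of_forall_le {f : PolymatroidRank R} {d : ℕ} {C : R → ℕ → ℤ}
    {x : R → ℕ} (hx : x ∈ f.base d)
    (h : ∀ y ∈ f.base d, ∑ r, C r (x r) ≤ ∑ r, C r (y r)) :
    f.LocallyOptimal d (fun r k => C r (k + 1) - C r k) x := by
  refine ⟨hx, fun z p q hz hq => ?_⟩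
  have h1 := h _ hq
  rw [hz, sum_comp_addUnit, sum_comp_addUnit] at h1
  simpa using h1

theorem exists_eq_single_of_sum_eq_one {g : R → ℕ} (h : ∑ r, g r = 1) :
    ∃ q, g = Pi.single q 1 := by
  obtain ⟨q, -, hq⟩ : ∃ q ∈ Finset.univ, g q ≠ 0 :=
    Finset.exists_ne_zero_of_sum_ne_zero (by omega)
  rw [← Finset.add_sum_erase _ _ (Finset.mem_univ q)] at h
  refine ⟨q, funext fun r => ?_⟩
  by_cases hr : r = q
  · subst hr
    simp
    omega
  · have h0 : ∑ r ∈ Finset.univ.erase q, g r = 0 := by omega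
    simpa [hr] using (Finset.sum_eq_zero_iff.1 h0) r (by simp [hr])

end

end PolymatroidRank

/-- The vector `a` with one unit less on `r`, truncated at zero. -/
def subUnit {R : Type*} [DecidableEq R] (a : R → ℕ) (r : R) : R → ℕ :=
  fun t => a t - if t = r then 1 else 0

theorem subUnit_addUnit {R : Type*} [DecidableEq R] (a : R → ℕ) (r : R) :
    subUnit (addUnit a r) r = a := by
  ext t
  simp [subUnit, addUnit]

theorem subUnit_of_ne {R : Type*} [DecidableEq R] (a : R → ℕ) {r t : R} (h : t ≠ r) :
    subUnit a r t = a t := by simp [subUnit, h]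

theorem subUnit_eq_self {R : Type*} [DecidableEq R] {a : R → ℕ} {r : R} (h : a r = 0) :
    subUnit a r = a := by
  ext t
  by_cases ht : t = r
  · subst ht; simp [subUnit, h]
  · simp [subUnit, ht]

theorem sum_range_addUnit {R : Type*} [Fintype R] [DecidableEq R] (g : R → ℕ → ℕ)
    (z : R → ℕ) (p : R) :
    ∑ r, ∑ k ∈ Finset.range (addUnit z p r), g r k =
      ∑ r, ∑ k ∈ Finset.range (z r), g r k + g p (z p) := by
  have h : ∀ r, ∑ k ∈ Finset.range (addUnit z p r), g r k =
      ∑ k ∈ Finset.range (z r), g r k + if r = p then g r (z r) else 0 := by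
    intro r
    by_cases hr : r = p
    · simp [addUnit, hr, Finset.sum_range_succ]
    · simp [addUnit, hr]
  simp [h, Finset.sum_add_distrib]

/-! ### Increments, best responses, and their stability under unit moves -/

namespace PolymatroidGame

section

variable {N R : Type*} [Fintype N] [DecidableEq N] [Fintype R] [DecidableEq R]
  (G : PolymatroidGame N R)

/-- The increase of the cost of player `i` on resource `r` when a unit is added there by `i`, at
the load `L`, of which `k` units belong to `i`. -/
def inc (i : N) (r : R) (L k : ℕ) : ℤ := G.c i r (L + 1) * (k + 1) - G.c i r L * k

/-- This is strong semi-convexity with the own units split off the load: `a` and `b` are the loads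
of the others. -/
theorem inc_mono (i : N) (r : R) {a b k l : ℕ} (hab : a ≤ b) (hkl : k ≤ l)
    (hl : l + 1 ≤ (G.f i).rank {r}) : G.inc i r (a + k) k ≤ G.inc i r (b + l) l := by
  have := G.cost_ssc i r (k + 1) (l + 1) a b (by omega) (by omega) hl hab
  simpa [inc, add_assoc] using this

/-- At a fixed total load the increment is affine in the own units, with slope `c(L + 1) - c(L) ≥
0`. It applies when a unit on a resource changes its owner. -/
theorem inc_le_inc_own (i : N) (r : R) {L k l : ℕ} (hkl : k ≤ l) :
    G.inc i r L k ≤ G.inc i r L l := by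
  have h1 : (G.c i r L : ℤ) ≤ G.c i r (L + 1) := by
    exact_mod_cast G.cost_mono i r (Nat.le_succ L)
  have h2 : (k : ℤ) ≤ l := by exact_mod_cast hkl
  unfold inc
  nlinarith

/-- `x` is a strategy of player `i` with demand `d` that is locally optimal when the others cause
the load `a`. -/
def OptAt (i : N) (d : ℕ) (a x : R → ℕ) : Prop :=
  (G.f i).LocallyOptimal d (fun r k => G.inc i r (a r + k) k) x

variable {G}

/-- Adding a unit where this is cheapest preserves optimality. -/
theorem OptAt.insert {i : N} {d : ℕ} {a x : R → ℕ} (hx : G.OptAt i d a x) {r : R}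
    (hr : addUnit x r ∈ (G.f i).base (d + 1))
    (hmin : ∀ q, addUnit x q ∈ (G.f i).base (d + 1) →
      G.inc i r (a r + x r) (x r) ≤ G.inc i q (a q + x q) (x q)) :
    G.OptAt i (d + 1) a (addUnit x r) := by
  refine ⟨hr, fun z p q hz hq => ?_⟩
  by_cases hpr : p = r
  · subst hpr
    obtain rfl := addUnit_injective hz
    exact hmin q hq
  · have hxp : x p = z p + 1 := by
      have := congrFun hz p
      simpa [addUnit, hpr] using this
    obtain ⟨z', rfl⟩ := exists_eq_addUnit (x := x) (p := p) (by omega)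
    rw [addUnit_comm] at hz
    obtain rfl := addUnit_injective hz
    -- Dropping the new unit on `r` from the deviation leaves a strategy for the old demand, so the
    -- old optimality compares `p` with `q`.
    have hle : addUnit z' q ∈ (G.f i).base d := by
      refine base_of_le hq (fun t => by simp only [addUnit]; omega) ?_
      have := hx.1.2
      rw [univ_sum_addUnit] at this ⊢
      exact this
    have h1 := hx.2 z' p q rfl hle
    have h2 := le_rank_singleton hq q
    rw [addUnit_self] at h2
    have h3 := G.inc_mono i q (le_refl (a q)) (k := z' q) (l := addUnit z' r q)
      (by simp [addUnit]) h2
    have h4 : addUnit z' r p = z' p := addUnit_of_ne _ hpr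
    simp only [h4] at h1 ⊢
    exact h1.trans h3

/-- After the load of the others has grown by one unit on `r`, moving a unit from `r` to where it
is cheapest restores optimality. -/
theorem OptAt.reinsert {i : N} {d : ℕ} {a z : R → ℕ} {r s : R}
    (hx : G.OptAt i d a (addUnit z r)) (hs : addUnit z s ∈ (G.f i).base d)
    (hmin : ∀ q, addUnit z q ∈ (G.f i).base d →
      G.inc i s (addUnit a r s + z s) (z s) ≤ G.inc i q (addUnit a r q + z q) (z q)) :
    G.OptAt i d (addUnit a r) (addUnit z s) := by
  refine ⟨hs, fun z' p q hz hq => ?_⟩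
  by_cases hps : p = s
  · subst hps
    obtain rfl := addUnit_injective hz
    exact hmin q hq
  by_cases hpq : p = q
  · subst hpq
    exact le_rfl
  have hzp : z p = z' p + 1 := by
    have := congrFun hz p
    simpa [addUnit, hps] using this
  obtain ⟨y, rfl⟩ := exists_eq_addUnit (x := z) (p := p) (by omega)
  rw [addUnit_comm] at hz
  obtain rfl := addUnit_injective hz
  have hx1 : addUnit (addUnit y r) p ∈ (G.f i).base d := addUnit_comm y p r ▸ hx.1
  -- Exchange between the old strategy `y + r + p` and the deviation `y + s + q`. The element `v`
  -- offered for `p` must be `q` or `s`.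
  obtain ⟨v, w, hw, hv, hb1, hb2⟩ := exchange hx1 hq (u := p)
    (by rw [addUnit_of_ne _ hpq, addUnit_of_ne _ hps]; simp [addUnit])
  have h1 := hx.2 (addUnit y r) p v (addUnit_comm _ _ _) hb1
  -- The increment on `p` has not grown: for `p = r` the total load is the same, but one unit went
  -- from the player to the others.
  have hL : G.inc i p (addUnit a r p + addUnit y s p) (addUnit y s p) ≤
      G.inc i p (a p + addUnit y r p) (addUnit y r p) := by
    rw [addUnit_of_ne _ hps]
    by_cases hpr : p = r
    · subst hpr
      simp only [addUnit_self]
      have := G.inc_le_inc_own i p (L := a p + 1 + y p) (Nat.le_succ (y p))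
      simpa [add_assoc, add_comm, add_left_comm] using this
    · rw [addUnit_of_ne _ hpr, addUnit_of_ne _ hpr]
  refine hL.trans (h1.trans ?_)
  have hqr := le_rank_singleton hq q
  rw [addUnit_self] at hqr
  by_cases hvq : v = q
  · subst hvq
    refine G.inc_mono i v (by simp [addUnit]) ?_ hqr
    rw [addUnit_self] at hv
    omega
  -- For `v = s` the exchange also shows that `z + q` is a strategy, and the choice of `s` as a
  -- cheapest insertion takes over.
  · have hvs : v = s := by
      by_contra hvs
      rw [addUnit_of_ne _ hvq, addUnit_of_ne _ hvs] at hv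
      simp [addUnit] at hv
    subst hvs
    have hvr : v ≠ r := by
      rintro rfl
      rw [addUnit_of_ne _ hvq] at hv
      omega
    have hw' : w = addUnit y q := by
      rw [addUnit_comm] at hw
      exact (addUnit_injective hw).symm
    rw [hw', addUnit_comm] at hb2
    have h2 := hmin q hb2
    rw [addUnit_of_ne _ (Ne.symm hps), addUnit_of_ne _ hvr, addUnit_of_ne _ (Ne.symm hpq)] at h2
    rw [addUnit_of_ne _ hvr, addUnit_of_ne y (Ne.symm hvq)]
    exact h2

/-- If a strategy is optimal after a unit has been moved from `r` to `s`, then it is still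
optimal when the load of the others on `s` drops by one. -/
theorem OptAt.subUnit_of_move {i : N} {d : ℕ} {a z : R → ℕ} {r s : R}
    (hx : G.OptAt i d a (addUnit z r)) (hy : G.OptAt i d (addUnit a r) (addUnit z s)) :
    G.OptAt i d (subUnit (addUnit a r) s) (addUnit z s) := by
  by_cases hsr : s = r
  · subst hsr
    rwa [subUnit_addUnit]
  by_cases h0 : addUnit a r s = 0
  · rwa [subUnit_eq_self h0]
  refine ⟨hy.1, fun z' p q hz hq => ?_⟩
  by_cases hpq : p = q
  · subst hpq
    exact le_rfl
  have h1 := hy.2 z' p q hz hq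
  have hpr := le_rank_singleton hy.1 p
  rw [hz, addUnit_self] at hpr
  -- Discounting a unit on `s` favours only deviations to `s`; for these, a further unit on `s` now
  -- meets the total load that the first one met, with one more own unit. For `q ≠ s` only the
  -- increment on `p` can drop.
  by_cases hqs : q = s
  · subst hqs
    have hzp : z p = z' p + 1 := by
      have := congrFun hz p
      simpa [addUnit, hpq] using this
    obtain ⟨y, rfl⟩ := exists_eq_addUnit (x := z) (p := p) (by omega)
    rw [addUnit_comm] at hz
    obtain rfl := addUnit_injective hz
    have hx1 : addUnit (addUnit y r) p ∈ (G.f i).base d := addUnit_comm y p r ▸ hx.1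
    -- The deviation `y + q + q` exceeds `y + r` only on `q`, so the old optimality compares `p`
    -- with `q`.
    obtain ⟨v, w, hw, hv, hb1, -⟩ := exchange hx1 hq (u := p)
      (by rw [addUnit_of_ne _ hpq, addUnit_of_ne _ hpq]; simp [addUnit])
    have hvq : v = q := by
      by_contra hvq
      rw [addUnit_of_ne _ hvq, addUnit_of_ne _ hvq] at hv
      simp [addUnit] at hv
    subst hvq
    have h2 := hx.2 (addUnit y r) p v (addUnit_comm _ _ _) hb1
    rw [addUnit_of_ne _ hsr] at h0 h2
    have h3 : G.inc i v (a v + y v) (y v) ≤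
        G.inc i v (subUnit (addUnit a r) v v + addUnit y v v) (addUnit y v v) := by
      have h4 : subUnit (addUnit a r) v v + addUnit y v v = a v + y v := by
        simp [subUnit, addUnit, hsr]
        omega
      rw [h4]
      exact G.inc_le_inc_own i v (by simp)
    refine le_trans ?_ (h2.trans h3)
    beta_reduce
    rw [subUnit_of_ne _ hpq, addUnit_of_ne y hpq]
    by_cases hpr : p = r
    · subst hpr
      simp only [addUnit_self]
      have := G.inc_le_inc_own i p (L := a p + 1 + y p) (Nat.le_succ (y p))
      simpa [add_assoc, add_comm, add_left_comm] using this
    · rw [addUnit_of_ne _ hpr, addUnit_of_ne _ hpr]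
  · have h2 := G.inc_mono i p (a := subUnit (addUnit a r) s p) (b := addUnit a r p)
      (by simp [subUnit]) (le_refl (z' p)) hpr
    beta_reduce
    rw [subUnit_of_ne _ hqs]
    exact h2.trans h1

/-- If a strategy is optimal after a unit has been added on `r`, then it is still optimal when the
load of the others on `r` drops by one. -/
theorem OptAt.subUnit_of_insert {i : N} {d : ℕ} {a x : R → ℕ} {r : R}
    (hx : G.OptAt i d a x) (hy : G.OptAt i (d + 1) a (addUnit x r)) :
    G.OptAt i (d + 1) (subUnit a r) (addUnit x r) := by
  by_cases h0 : a r = 0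
  · rwa [subUnit_eq_self h0]
  refine ⟨hy.1, fun z' p q hz hq => ?_⟩
  by_cases hpq : p = q
  · subst hpq
    exact le_rfl
  have h1 := hy.2 z' p q hz hq
  have hpr := le_rank_singleton hy.1 p
  rw [hz, addUnit_self] at hpr
  -- Again only deviations to `r` profit. A second unit on `r` then meets the total load before the
  -- insertion, where `p` was no worse than `r` by `hx`.
  by_cases hqr : q = r
  · subst hqr
    have hxp : x p = z' p + 1 := by
      have := congrFun hz p
      simpa [addUnit, hpq] using this
    obtain ⟨y, rfl⟩ := exists_eq_addUnit (x := x) (p := p) (by omega)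
    rw [addUnit_comm] at hz
    obtain rfl := addUnit_injective hz
    have hle : addUnit y q ∈ (G.f i).base d := by
      refine base_of_le hq (fun t => by simp only [addUnit]; omega) ?_
      have := hx.1.2
      rw [univ_sum_addUnit] at this ⊢
      exact this
    have h2 := hx.2 y p q rfl hle
    beta_reduce
    rw [subUnit_of_ne _ hpq, addUnit_of_ne y hpq]
    refine h2.trans ?_
    have h4 : subUnit a q q + addUnit y q q = a q + y q := by
      simp [subUnit, addUnit]
      omega
    rw [h4]
    exact G.inc_le_inc_own i q (by simp)
  · have h2 := G.inc_mono i p (a := subUnit a r p) (b := a p)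
      (by simp [subUnit]) (le_refl (z' p)) hpr
    beta_reduce
    rw [subUnit_of_ne _ hqr]
    exact h2.trans h1

/-- The load that is caused by the players other than `i`. -/
def others (x : N → R → ℕ) (i : N) (r : R) : ℕ := ∑ j ∈ Finset.univ.erase i, x j r

theorem load_eq (x : N → R → ℕ) (i : N) (r : R) : ∑ j, x j r = others x i r + x i r :=
  (Finset.sum_erase_add _ _ (Finset.mem_univ i)).symm

theorem others_update (x : N → R → ℕ) (i : N) (y : R → ℕ) :
    others (Function.update x i y) i = others x i := by
  ext r
  refine Finset.sum_congr rfl fun j hj => ?_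
  rw [Function.update_of_ne (Finset.mem_erase.1 hj).1]

theorem load_update (x : N → R → ℕ) (i : N) (y : R → ℕ) (r : R) :
    ∑ j, Function.update x i y j r = others x i r + y r := by
  rw [load_eq _ i, others_update, Function.update_self]

variable (G) in
/-- The cost of player `i` on resource `r` when `i` puts `k` units there and the others cause the
load `a`. -/
def unitCost (i : N) (a : R → ℕ) (r : R) (k : ℕ) : ℤ := G.c i r (a r + k) * k

theorem privateCost_update (x : N → R → ℕ) (i : N) (y : R → ℕ) :
    (G.privateCost (Function.update x i y) i : ℤ) =
      ∑ r, G.unitCost i (others x i) r (y r) := by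
  simp [privateCost, load_update, unitCost]

theorem unitCost_sub (i : N) (a : R → ℕ) (r : R) (k : ℕ) :
    G.unitCost i a r (k + 1) - G.unitCost i a r k = G.inc i r (a r + k) k := by
  simp [inc, unitCost, add_assoc]

/-- By `inc_mono` the cost is separable convex up to the singleton ranks, so comparing single unit
exchanges suffices. -/
theorem isBestResponse_iff {e : N → ℕ} {x : N → R → ℕ} {i : N} {y : R → ℕ} :
    G.IsBestResponse e x i y ↔ G.OptAt i (e i) (others x i) y := by
  constructor
  · rintro ⟨hy, h⟩
    unfold OptAt
    simp only [← unitCost_sub]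
    refine locallyOptimal_of_forall_le hy fun z hz => ?_
    rw [← privateCost_update, ← privateCost_update]
    exact_mod_cast h z hz
  · intro h
    refine ⟨h.1, fun z hz => ?_⟩
    have h2 := h
    unfold OptAt at h2
    simp only [← unitCost_sub] at h2
    have h3 := LocallyOptimal.le_sum (fun r k l hkl hl => ?_) h2 hz
    · rw [← privateCost_update, ← privateCost_update] at h3
      exact_mod_cast h3
    · have := G.inc_mono i r (le_refl (others x i r)) hkl hl
      rwa [unitCost_sub, unitCost_sub]

theorem canImprove_iff {e : N → ℕ} {x : N → R → ℕ} {i : N} (hx : x i ∈ (G.f i).base (e i)) :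
    G.CanImprove e x i ↔ ¬ G.OptAt i (e i) (others x i) (x i) := by
  rw [← isBestResponse_iff]
  simp [CanImprove, IsBestResponse, hx]

theorem privateCost_lt_iff {x : N → R → ℕ} {i : N} {z : R → ℕ} {p q : R}
    (hx : x i = addUnit z p) :
    G.privateCost (Function.update x i (addUnit z q)) i < G.privateCost x i ↔
      G.inc i q (others x i q + z q) (z q) < G.inc i p (others x i p + z p) (z p) := by
  have h1 := G.privateCost_update x i (addUnit z p)
  have h2 := G.privateCost_update x i (addUnit z q)
  rw [sum_comp_addUnit, unitCost_sub] at h1 h2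
  rw [← hx, Function.update_eq_self] at h1
  zify
  rw [h1, h2]
  simp

theorem hamming_eq_sum (x y : R → ℕ) : hamming x y = ∑ r, (x r - y r) + ∑ r, (y r - x r) := by
  unfold hamming
  rw [← Finset.sum_add_distrib]
  exact Finset.sum_congr rfl fun r _ => by omega

theorem exists_of_hamming_eq_one {x y : R → ℕ} (h : hamming y x = 1)
    (hs : ∑ r, y r = ∑ r, x r + 1) : ∃ r, y = addUnit x r := by
  rw [hamming_eq_sum] at h
  have h1 : ∑ r, y r + ∑ r, (x r - y r) = ∑ r, x r + ∑ r, (y r - x r) := by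
    rw [← Finset.sum_add_distrib, ← Finset.sum_add_distrib]
    exact Finset.sum_congr rfl fun r _ => by omega
  obtain ⟨q, hq⟩ := exists_eq_single_of_sum_eq_one (g := fun r => y r - x r) (by omega)
  have h0 : ∑ r, (x r - y r) = 0 := by omega
  refine ⟨q, funext fun r => ?_⟩
  have h2 := congrFun hq r
  have h3 := (Finset.sum_eq_zero_iff.1 h0) r (Finset.mem_univ r)
  simp only [Pi.single_apply] at h2
  simp only [addUnit]
  omega

/-- With equal sums, excess and deficit are one unit each; `z` is the pointwise minimum. -/
theorem exists_of_hamming_eq_two {x y : R → ℕ} (h : hamming y x = 2)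
    (hs : ∑ r, y r = ∑ r, x r) : ∃ z p q, x = addUnit z p ∧ y = addUnit z q := by
  rw [hamming_eq_sum] at h
  have h1 : ∑ r, y r + ∑ r, (x r - y r) = ∑ r, x r + ∑ r, (y r - x r) := by
    rw [← Finset.sum_add_distrib, ← Finset.sum_add_distrib]
    exact Finset.sum_congr rfl fun r _ => by omega
  obtain ⟨q, hq⟩ := exists_eq_single_of_sum_eq_one (g := fun r => y r - x r) (by omega)
  obtain ⟨p, hp⟩ := exists_eq_single_of_sum_eq_one (g := fun r => x r - y r) (by omega)
  refine ⟨fun r => min (x r) (y r), p, q, funext fun r => ?_, funext fun r => ?_⟩ <;>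
  · have h2 := congrFun hq r
    have h3 := congrFun hp r
    simp only [Pi.single_apply] at h2 h3
    simp only [addUnit]
    omega

theorem hamming_addUnit (x : R → ℕ) (r : R) : hamming (addUnit x r) x = 1 := by
  have h : ∀ t, ((addUnit x r t : ℤ) - (x t : ℤ)).natAbs = if t = r then 1 else 0 := by
    intro t
    simp only [addUnit]
    split_ifs <;> simp
  simp [hamming, h]

theorem hamming_addUnit_addUnit (z : R → ℕ) {p q : R} (h : p ≠ q) :
    hamming (addUnit z q) (addUnit z p) = 2 := by
  have h1 : ∀ r, addUnit z q r - addUnit z p r = if r = q then 1 else 0 := by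
    intro r
    by_cases hr : r = q
    · subst hr
      simp [addUnit, h.symm]
    · simp [addUnit, hr]
  have h2 : ∀ r, addUnit z p r - addUnit z q r = if r = p then 1 else 0 := by
    intro r
    by_cases hr : r = p
    · subst hr
      simp [addUnit, h]
    · simp [addUnit, hr]
  simp [hamming_eq_sum, h1, h2]

end

end PolymatroidGame

/-! ### Analysis of the algorithm: potential, marked resource, number of iterations -/

namespace PolymatroidGame

section

variable {N R : Type*} [Fintype N] [DecidableEq N] [Fintype R] [DecidableEq R]
  (G : PolymatroidGame N R)

/-- The number of pairs of a resource `r` and a number of units below `D` at which the increase at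
the loads `ℓ` is less than `v`. -/
def incRank (D : ℕ) (ℓ : R → ℕ) (i : N) (v : ℤ) : ℕ :=
  (Finset.univ.filter fun p : R × Fin D => G.inc i p.1 (ℓ p.1) p.2 < v).card

/-- Strict because the pair `(r, k)` itself is not counted. The resulting `- 1` later pays for the
iteration that opens a phase. -/
theorem incRank_lt {D : ℕ} {ℓ : R → ℕ} {i : N} {v : ℤ} {r : R} {k : ℕ} (hk : k < D)
    (hv : v ≤ G.inc i r (ℓ r) k) : G.incRank D ℓ i v < Fintype.card R * D := by
  have h : G.incRank D ℓ i v < (Finset.univ : Finset (R × Fin D)).card := by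
    refine Finset.card_lt_card (Finset.ssubset_univ_iff.2 fun h => ?_)
    have := (Finset.ext_iff.1 h (r, ⟨k, hk⟩)).2 (Finset.mem_univ _)
    simp at this
    omega
  simpa using h

theorem incRank_lt_incRank {D : ℕ} {ℓ : R → ℕ} {i : N} {v : ℤ} {r : R} {k : ℕ} (hk : k < D)
    (hv : G.inc i r (ℓ r) k < v) :
    G.incRank D ℓ i (G.inc i r (ℓ r) k) < G.incRank D ℓ i v := by
  refine Finset.card_lt_card (Finset.ssubset_iff_of_subset ?_ |>.2 ⟨(r, ⟨k, hk⟩), ?_, ?_⟩)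
  · intro p hp
    simp only [Finset.mem_filter, Finset.mem_univ, true_and] at hp ⊢
    exact hp.trans hv
  · simpa using hv
  · simp

/-- The contribution of player `i` with strategy `x` to the potential. -/
def playerPotential (D : ℕ) (ℓ : R → ℕ) (i : N) (x : R → ℕ) : ℕ :=
  ∑ r, ∑ k ∈ Finset.range (x r), G.incRank D ℓ i (G.inc i r (ℓ r) k)

/-- The potential: the sum of the ranks of the increases of all placed units. -/
def potential (D : ℕ) (ℓ : R → ℕ) (x : N → R → ℕ) : ℕ :=
  ∑ i, G.playerPotential D ℓ i (x i)

theorem playerPotential_le {D : ℕ} {ℓ : R → ℕ} {i : N} {x : R → ℕ} (hx : ∑ r, x r ≤ D) :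
    G.playerPotential D ℓ i x ≤ D * (Fintype.card R * D - 1) := by
  have h : ∀ r, ∑ k ∈ Finset.range (x r), G.incRank D ℓ i (G.inc i r (ℓ r) k) ≤
      x r * (Fintype.card R * D - 1) := by
    intro r
    have hr : x r ≤ D := (Finset.single_le_sum (f := x) (fun _ _ => Nat.zero_le _)
      (Finset.mem_univ r)).trans hx
    refine (Finset.sum_le_card_nsmul _ _ (Fintype.card R * D - 1) fun k hk => ?_).trans
      (by simp)
    have := G.incRank_lt (i := i) (ℓ := ℓ) (r := r) (k := k) (D := D)
      (by have := Finset.mem_range.1 hk; omega) le_rfl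
    omega
  calc _ ≤ ∑ r, x r * (Fintype.card R * D - 1) := Finset.sum_le_sum fun r _ => h r
    _ = (∑ r, x r) * (Fintype.card R * D - 1) := by rw [Finset.sum_mul]
    _ ≤ _ := Nat.mul_le_mul_right _ hx

theorem potential_le {D : ℕ} {ℓ : R → ℕ} {x : N → R → ℕ} (hx : ∀ i, ∑ r, x i r ≤ D) :
    G.potential D ℓ x ≤ Fintype.card N * (D * (Fintype.card R * D - 1)) := by
  refine (Finset.sum_le_card_nsmul _ _ _ fun i _ => G.playerPotential_le (hx i)).trans ?_
  simp

theorem playerPotential_move {D : ℕ} {ℓ : R → ℕ} {i : N} {z : R → ℕ} {r s : R} (hs : z s < D)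
    (h : G.inc i s (ℓ s) (z s) < G.inc i r (ℓ r) (z r)) :
    G.playerPotential D ℓ i (addUnit z s) < G.playerPotential D ℓ i (addUnit z r) := by
  unfold playerPotential
  rw [sum_range_addUnit, sum_range_addUnit]
  have := G.incRank_lt_incRank hs h
  omega

theorem potential_move {D : ℕ} {ℓ : R → ℕ} {x : N → R → ℕ} {i : N} {z : R → ℕ} {r s : R}
    (hx : x i = addUnit z r) (hs : z s < D)
    (h : G.inc i s (ℓ s) (z s) < G.inc i r (ℓ r) (z r)) :
    G.potential D ℓ (Function.update x i (addUnit z s)) < G.potential D ℓ x := by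
  refine Finset.sum_lt_sum (fun j _ => ?_) ⟨i, Finset.mem_univ i, ?_⟩
  · by_cases hj : j = i
    · subst hj
      rw [Function.update_self, hx]
      exact (G.playerPotential_move hs h).le
    · rw [Function.update_of_ne hj]
  · rw [Function.update_self, hx]
    exact G.playerPotential_move hs h

/-- All players are at a best response with respect to the load without one unit on `r`. -/
structure Marked (s : AlgState N R) (r : R) : Prop where
  opt : ∀ i, G.OptAt i (s.demand i) (subUnit (others s.profile i) r) (s.profile i)
  pos : 0 < ∑ i, s.profile i r

/-- The facts about the demands and the strategies that hold in every state of a run. -/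
structure Feasible (s : AlgState N R) : Prop where
  base : ∀ i, s.profile i ∈ (G.f i).base (s.demand i)
  le : ∀ i, s.demand i ≤ G.demand i
  sum : ∑ i, s.demand i = s.k

/-- A bound on the number of iterations between two increments of a demand. -/
def phaseBound : ℕ :=
  -- The `+ 1` is the iteration of the for-loop that opens the phase.
  Fintype.card N * (G.maxDemand * (Fintype.card R * G.maxDemand - 1)) + 1

variable {G}

theorem others_update_addUnit {x : N → R → ℕ} {i j : N} (hij : j ≠ i) {z : R → ℕ} {s : R} :
    others (Function.update x i (addUnit z s)) j =
      addUnit (others (Function.update x i z) j) s := by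
  ext t
  have h : i ∈ Finset.univ.erase j := Finset.mem_erase.2 ⟨hij.symm, Finset.mem_univ i⟩
  have h2 : ∀ y : R → ℕ, ∑ l ∈ (Finset.univ.erase j).erase i, Function.update x i y l t =
      ∑ l ∈ (Finset.univ.erase j).erase i, x l t := fun y =>
    Finset.sum_congr rfl fun l hl => by rw [Function.update_of_ne (Finset.mem_erase.1 hl).1]
  simp only [others, addUnit]
  rw [← Finset.add_sum_erase _ _ h, ← Finset.add_sum_erase _ _ h, h2, h2]
  simp only [Function.update_self, addUnit]
  omega

theorem Feasible.demand_le_maxDemand {s : AlgState N R} (h : G.Feasible s) (i : N) :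
    s.demand i ≤ G.maxDemand :=
  (h.le i).trans (Finset.le_sup (f := G.demand) (Finset.mem_univ i))

theorem Feasible.insert {s : AlgState N R} (h : G.Feasible s) {i : N} {y : R → ℕ}
    (hi : s.demand i < G.demand i) (hy : y ∈ (G.f i).base (s.demand i + 1)) :
    G.Feasible ⟨s.k + 1, Function.update s.demand i (s.demand i + 1),
      Function.update s.profile i y⟩ where
  base j := by
    by_cases hj : j = i
    · subst hj
      simpa using hy
    · simpa [hj] using h.base j
  le j := by
    by_cases hj : j = i
    · subst hj
      simpa using hi
    · simpa [hj] using h.le j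
  sum := by
    have h1 := Finset.add_sum_erase Finset.univ s.demand (Finset.mem_univ i)
    rw [h.sum] at h1
    rw [← Finset.add_sum_erase _ _ (Finset.mem_univ i),
      Finset.sum_congr rfl (g := fun j => s.demand j) fun j hj => by
        simp [(Finset.mem_erase.1 hj).1]]
    simp only [Function.update_self]
    omega

theorem Feasible.move {s : AlgState N R} (h : G.Feasible s) {i : N} {y : R → ℕ}
    (hy : y ∈ (G.f i).base (s.demand i)) :
    G.Feasible ⟨s.k, s.demand, Function.update s.profile i y⟩ where
  base j := by
    by_cases hj : j = i
    · subst hj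
      simpa using hy
    · simpa [hj] using h.base j
  le := h.le
  sum := h.sum

theorem Feasible.optAt {s : AlgState N R} (h : G.Feasible s) {i : N}
    (hi : ¬ G.CanImprove s.demand s.profile i) :
    G.OptAt i (s.demand i) (others s.profile i) (s.profile i) := by
  rwa [canImprove_iff (h.base i), not_not] at hi

/-- For the other players, discounting the new unit restores the load at which they were optimal.
For `i` itself this is `OptAt.subUnit_of_insert`. -/
theorem marked_insert {s : AlgState N R} (h : G.Feasible s)
    (hopt : ∀ j, ¬ G.CanImprove s.demand s.profile j) {i : N} {r : R}
    (hy : G.OptAt i (s.demand i + 1) (others s.profile i) (addUnit (s.profile i) r)) :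
    G.Marked ⟨s.k + 1, Function.update s.demand i (s.demand i + 1),
      Function.update s.profile i (addUnit (s.profile i) r)⟩ r where
  opt j := by
    by_cases hj : j = i
    · subst hj
      simpa [others_update] using (h.optAt (hopt j)).subUnit_of_insert hy
    · simpa [hj, others_update_addUnit hj, subUnit_addUnit] using h.optAt (hopt j)
  pos := by
    refine lt_of_lt_of_le ?_ (Finset.single_le_sum (fun _ _ => Nat.zero_le _)
      (Finset.mem_univ i))
    simp

theorem Marked.others_eq_addUnit {s : AlgState N R} {r : R} {i : N}
    (hpos : 0 < others s.profile i r) :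
    addUnit (subUnit (others s.profile i) r) r = others s.profile i := by
  ext t
  simp only [addUnit, subUnit]
  split_ifs with ht
  · subst ht; omega
  · omega

/-- If the others have nothing on `r`, the truncated subtraction discounts nothing, and the mark
already asserts optimality. -/
theorem Marked.others_pos {s : AlgState N R} {r : R} (h : G.Marked s r) {i : N}
    (hi : ¬ G.OptAt i (s.demand i) (others s.profile i) (s.profile i)) :
    0 < others s.profile i r := by
  by_contra h0
  refine hi ?_
  have := h.opt i
  rwa [subUnit_eq_self (by omega)] at this

/-- Every improving exchange removes a unit from the marked resource. -/
theorem Marked.eq_of_lt {s : AlgState N R} {r : R} (h : G.Marked s r) {i : N} {z : R → ℕ}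
    {p q : R} (hz : s.profile i = addUnit z p)
    (hq : addUnit z q ∈ (G.f i).base (s.demand i))
    (hlt : G.inc i q (others s.profile i q + z q) (z q) <
      G.inc i p (others s.profile i p + z p) (z p)) : p = r := by
  by_contra hpr
  -- If `p` is not marked, restoring the discounted unit leaves the increment on `p` alone and can
  -- only raise the one on `q`.
  have h1 := (h.opt i).2 z p q hz hq
  have h2 := le_rank_singleton hq q
  rw [addUnit_self] at h2
  have h3 := G.inc_mono i q (a := subUnit (others s.profile i) r q)
    (b := others s.profile i q) (by simp [subUnit]) (le_refl (z q)) h2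
  simp only [subUnit_of_ne _ hpr] at h1
  omega

/-- The other players see the same discounted load before and after, since the moved unit is the one
left out. For the mover, `OptAt.subUnit_of_move` is applied to the load with `r` discounted. -/
theorem Marked.move {s : AlgState N R} {r : R} (h : G.Marked s r) {i : N} {z : R → ℕ} {t : R}
    (hpos : 0 < others s.profile i r) (hz : s.profile i = addUnit z r)
    (hy : G.OptAt i (s.demand i) (others s.profile i) (addUnit z t)) :
    G.Marked ⟨s.k, s.demand, Function.update s.profile i (addUnit z t)⟩ t where
  opt j := by
    by_cases hj : j = i
    · subst hj
      have h1 := h.opt j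
      rw [hz] at h1
      have h2 := h1.subUnit_of_move (s := t) (by rwa [others_eq_addUnit hpos])
      simpa [others_update, others_eq_addUnit hpos] using h2
    · have h1 := h.opt j
      have h2 : s.profile = Function.update s.profile i (addUnit z r) := by
        rw [← hz, Function.update_eq_self]
      rw [h2, others_update_addUnit hj, subUnit_addUnit] at h1
      simpa [hj, others_update_addUnit hj, subUnit_addUnit] using h1
  pos := by
    refine lt_of_lt_of_le ?_ (Finset.single_le_sum (fun _ _ => Nat.zero_le _)
      (Finset.mem_univ i))
    simp

/-- A unit of player `i` on the marked resource, when it is removed and inserted again where it is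
cheapest, yields a best response. -/
theorem Marked.optAt_reinsert {s : AlgState N R} {r : R} (h : G.Marked s r) {i : N} {z : R → ℕ}
    {t : R} (hpos : 0 < others s.profile i r) (hz : s.profile i = addUnit z r)
    (ht : addUnit z t ∈ (G.f i).base (s.demand i))
    (hmin : ∀ q, addUnit z q ∈ (G.f i).base (s.demand i) →
      G.inc i t (others s.profile i t + z t) (z t) ≤
        G.inc i q (others s.profile i q + z q) (z q)) :
    G.OptAt i (s.demand i) (others s.profile i) (addUnit z t) := by
  have h1 := h.opt i
  rw [hz] at h1
  have h2 := h1.reinsert ht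
  rw [others_eq_addUnit hpos] at h2
  exact h2 hmin

theorem exists_min_insert {i : N} {d : ℕ} {a z : R → ℕ} (h : ∃ q, addUnit z q ∈ (G.f i).base d) :
    ∃ t, addUnit z t ∈ (G.f i).base d ∧ ∀ q, addUnit z q ∈ (G.f i).base d →
      G.inc i t (a t + z t) (z t) ≤ G.inc i q (a q + z q) (z q) := by
  classical
  obtain ⟨q, hq⟩ := h
  obtain ⟨t, ht, hmin⟩ := Finset.exists_min_image
    (Finset.univ.filter fun q => addUnit z q ∈ (G.f i).base d)
    (fun q => G.inc i q (a q + z q) (z q)) ⟨q, by simpa using hq⟩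
  exact ⟨t, by simpa using ht, fun q hq => hmin q (by simpa using hq)⟩

theorem exists_addUnit_of_canImprove {s : AlgState N R} (hF : G.Feasible s) {i : N}
    (hi : G.CanImprove s.demand s.profile i) :
    ∃ z p q, s.profile i = addUnit z p ∧ addUnit z q ∈ (G.f i).base (s.demand i) ∧
      G.inc i q (others s.profile i q + z q) (z q) <
        G.inc i p (others s.profile i p + z p) (z p) := by
  rw [canImprove_iff (hF.base i)] at hi
  by_contra! hcon
  exact hi ⟨hF.base i, fun z p q hz hq => hcon z p q hz hq⟩

/-- The number of iterations before the current phase and the potential bound the number of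
iterations that remain in the phase. -/
def TimeInv (G : PolymatroidGame N R) (T : ℕ) (s : AlgState N R) : Prop :=
  (s = AlgState.init N R ∧ T = 0) ∨ ∃ r, G.Marked s r ∧
    T + G.potential G.maxDemand (subUnit (fun r => ∑ i, s.profile i r) r) s.profile ≤
      s.k * G.phaseBound

theorem not_canImprove_init (i : N) :
    ¬ G.CanImprove (AlgState.init N R).demand (AlgState.init N R).profile i := by
  rintro ⟨y, -, h⟩
  have : G.privateCost (AlgState.init N R).profile i = 0 := by
    simp [privateCost, AlgState.init]
  omega

theorem feasible_init : G.Feasible (AlgState.init N R) where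
  base i := ⟨by simp [AlgState.init], by simp [AlgState.init]⟩
  le i := Nat.zero_le _
  sum := by simp [AlgState.init]

/-- This fixes the loads at which increments are ranked for a whole phase, so potentials before and
after a move are comparable. -/
theorem load_move_eq {x : N → R → ℕ} {i : N} {z : R → ℕ} {r t : R} (hz : x i = addUnit z r) :
    subUnit (fun u => ∑ j, Function.update x i (addUnit z t) j u) t =
      subUnit (fun u => ∑ j, x j u) r := by
  ext u
  simp only [load_update, load_eq x i, hz, subUnit, addUnit]
  split_ifs <;> omega

/-- A for-step buys a full phase budget, which covers itself and the largest possible potential; a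
while-step is paid for by a drop of the potential. -/
theorem AlgStep.inv {s s' : AlgState N R} {T : ℕ} (hs : G.AlgStep s s') (hF : G.Feasible s)
    (hT : G.TimeInv T s) : G.Feasible s' ∧ G.TimeInv (T + 1) s' := by
  cases hs with
  | forStep i y hk hexit hi hy hd =>
    have hb : y ∈ (G.f i).base (s.demand i + 1) := by simpa using hy.1
    rw [isBestResponse_iff, Function.update_self] at hy
    have hF' := hF.insert hi hb
    refine ⟨hF', Or.inr ?_⟩
    obtain ⟨r, rfl⟩ := exists_of_hamming_eq_one hd (by rw [hb.2, (hF.base i).2])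
    refine ⟨r, marked_insert hF (fun j hj => hexit ⟨j, hj⟩) hy, ?_⟩
    have h1 : T ≤ s.k * G.phaseBound := by
      rcases hT with ⟨-, rfl⟩ | ⟨r, -, h⟩ <;> omega
    have h2 := G.potential_le (D := G.maxDemand)
      (ℓ := subUnit (fun u => ∑ j, Function.update s.profile i (addUnit (s.profile i) r) j u) r)
      (x := Function.update s.profile i (addUnit (s.profile i) r))
      (fun j => by rw [(hF'.base j).2]; exact hF'.demand_le_maxDemand j)
    simp only [Nat.succ_mul]
    unfold phaseBound at h1 ⊢
    omega
  | whileStep i y hi hy hd =>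
    have hb := hy.1
    rw [isBestResponse_iff] at hy
    refine ⟨hF.move hb, Or.inr ?_⟩
    rcases hT with ⟨rfl, -⟩ | ⟨r, hM, hT⟩
    · exact absurd hi (not_canImprove_init i)
    obtain ⟨z, p, t, hz, rfl⟩ := exists_of_hamming_eq_two hd (by rw [hb.2, (hF.base i).2])
    have hlt : G.inc i t (others s.profile i t + z t) (z t) <
        G.inc i p (others s.profile i p + z p) (z p) := by
      rw [← privateCost_lt_iff hz]
      obtain ⟨w, hw, hlt⟩ := hi
      exact ((isBestResponse_iff.2 hy).2 w hw).trans_lt hlt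
    -- The algorithm does not know the mark, yet any improving move at distance two leaves it.
    obtain rfl := hM.eq_of_lt hz hb hlt
    have hpos := hM.others_pos ((canImprove_iff (hF.base i)).1 hi)
    refine ⟨t, hM.move hpos hz hy, ?_⟩
    simp only [load_move_eq hz]
    have hpt : t ≠ p := by
      rintro rfl
      exact lt_irrefl _ hlt
    have hmax := (hF.move hb).demand_le_maxDemand i
    have hzt : z t < G.maxDemand := by
      refine lt_of_lt_of_le ?_ hmax
      rw [← hb.2]
      refine lt_of_lt_of_le ?_ (Finset.single_le_sum (fun _ _ => Nat.zero_le _)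
        (Finset.mem_univ t))
      simp
    -- On both `p` and `t` the discounted load is the load of the others plus `z`, so the ranked
    -- increments are those that the improvement compares.
    have h1 := G.potential_move (D := G.maxDemand)
      (ℓ := subUnit (fun u => ∑ j, s.profile j u) p) hz hzt (by
        simp only [load_eq s.profile i, hz]
        have e1 : subUnit (fun u => others s.profile i u + addUnit z p u) p t =
            others s.profile i t + z t := by simp [subUnit, addUnit, hpt]
        have e2 : subUnit (fun u => others s.profile i u + addUnit z p u) p p =
            others s.profile i p + z p := by simp [subUnit, ← add_assoc]
        rwa [e1, e2])
    omega

theorem AlgRun.inv {s : AlgState N R} {T : ℕ} (h : G.AlgRun T s) :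
    G.Feasible s ∧ G.TimeInv T s := by
  induction h with
  | start => exact ⟨feasible_init, Or.inl ⟨rfl, rfl⟩⟩
  | step _ h' ih => exact h'.inv ih.1 ih.2

theorem one_le_maxDemand [Nonempty N] : 1 ≤ G.maxDemand := by
  obtain ⟨i⟩ := ‹Nonempty N›
  exact (G.demand_pos i).trans (Finset.le_sup (f := G.demand) (Finset.mem_univ i))

theorem sum_demand_le : ∑ i, G.demand i ≤ Fintype.card N * G.maxDemand := by
  refine (Finset.sum_le_card_nsmul _ _ G.maxDemand fun i hi => Finset.le_sup hi).trans ?_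
  simp

/-- The `+ 1` is absorbed by the `- 1` because `n * δ ≥ 1`. -/
theorem phaseBound_le [Nonempty N] [Nonempty R] :
    G.phaseBound ≤ Fintype.card N * Fintype.card R * G.maxDemand ^ 2 := by
  have h1 : 1 ≤ G.maxDemand := one_le_maxDemand
  have h2 : 1 ≤ Fintype.card N := Fintype.card_pos
  have h3 : 1 ≤ Fintype.card R := Fintype.card_pos
  obtain ⟨e, he⟩ : ∃ e, Fintype.card R * G.maxDemand = e + 1 :=
    ⟨_, (Nat.succ_pred_eq_of_pos (Nat.mul_pos h3 h1)).symm⟩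
  unfold phaseBound
  have h4 : Fintype.card N * Fintype.card R * G.maxDemand ^ 2 =
      Fintype.card N * (G.maxDemand * (Fintype.card R * G.maxDemand)) := by ring
  rw [h4, he, Nat.add_sub_cancel]
  have h5 : 1 ≤ Fintype.card N * G.maxDemand := Nat.mul_pos h2 h1
  nlinarith

theorem AlgRun.le_sum_mul {s : AlgState N R} {T : ℕ} (h : G.AlgRun T s) :
    T ≤ (∑ i, G.demand i) * G.phaseBound := by
  obtain ⟨hF, hT⟩ := h.inv
  have h1 : s.k ≤ ∑ i, G.demand i := hF.sum ▸ Finset.sum_le_sum fun i _ => hF.le i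
  have h2 := Nat.mul_le_mul_right G.phaseBound h1
  rcases hT with ⟨-, rfl⟩ | ⟨r, -, h⟩ <;> omega

theorem AlgRun.le [Nonempty N] [Nonempty R] {s : AlgState N R} {T : ℕ} (h : G.AlgRun T s) :
    T ≤ Fintype.card N ^ (G.maxDemand + 1) * Fintype.card R ^ G.maxDemand *
      G.maxDemand ^ (G.maxDemand + 1) := by
  have h1 : 1 ≤ G.maxDemand := one_le_maxDemand
  have h2 : 1 ≤ Fintype.card N := Fintype.card_pos
  have h3 : 1 ≤ Fintype.card R := Fintype.card_pos
  refine h.le_sum_mul.trans ((Nat.mul_le_mul sum_demand_le phaseBound_le).trans ?_)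
  have h4 : Fintype.card N * G.maxDemand *
      (Fintype.card N * Fintype.card R * G.maxDemand ^ 2) =
      Fintype.card N ^ 2 * Fintype.card R ^ 1 * G.maxDemand ^ 3 := by ring
  rw [h4]
  -- For `δ = 1` the two bounds coincide; for `δ ≥ 2` each exponent of the claimed bound is at least
  -- the one needed.
  rcases h1.eq_or_lt with h5 | h5
  · simp [← h5]
  · gcongr <;> omega

/-- Inserting a new unit where it is cheapest is an iteration of the for-loop. -/
theorem algStep_insert {s : AlgState N R} (hF : G.Feasible s)
    (hopt : ∀ j, ¬ G.CanImprove s.demand s.profile j) {i : N} (hi : s.demand i < G.demand i)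
    {r : R} (hr : addUnit (s.profile i) r ∈ (G.f i).base (s.demand i + 1))
    (hmin : ∀ q, addUnit (s.profile i) q ∈ (G.f i).base (s.demand i + 1) →
      G.inc i r (others s.profile i r + s.profile i r) (s.profile i r) ≤
        G.inc i q (others s.profile i q + s.profile i q) (s.profile i q)) :
    G.AlgStep s ⟨s.k + 1, Function.update s.demand i (s.demand i + 1),
      Function.update s.profile i (addUnit (s.profile i) r)⟩ ∧
    G.Marked ⟨s.k + 1, Function.update s.demand i (s.demand i + 1),
      Function.update s.profile i (addUnit (s.profile i) r)⟩ r := by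
  have hy := (hF.optAt (hopt i)).insert hr hmin
  refine ⟨AlgStep.forStep s i _ ?_ (fun ⟨j, hj⟩ => hopt j hj) hi ?_ (hamming_addUnit _ _),
    marked_insert hF hopt hy⟩
  · rw [← hF.sum]
    exact Finset.sum_lt_sum (fun j _ => hF.le j) ⟨i, Finset.mem_univ i, hi⟩
  · rwa [isBestResponse_iff, Function.update_self]

/-- Moving a unit from the marked resource to where it is cheapest is an iteration of the
while-loop, provided that the cost drops. -/
theorem Marked.algStep_move {s : AlgState N R} {r : R} (h : G.Marked s r) (hF : G.Feasible s)
    {i : N} {z : R → ℕ} {t : R} (hz : s.profile i = addUnit z r)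
    (ht : addUnit z t ∈ (G.f i).base (s.demand i))
    (hmin : ∀ q, addUnit z q ∈ (G.f i).base (s.demand i) →
      G.inc i t (others s.profile i t + z t) (z t) ≤
        G.inc i q (others s.profile i q + z q) (z q))
    (hlt : G.inc i t (others s.profile i t + z t) (z t) <
      G.inc i r (others s.profile i r + z r) (z r)) :
    G.AlgStep s ⟨s.k, s.demand, Function.update s.profile i (addUnit z t)⟩ ∧
    G.Marked ⟨s.k, s.demand, Function.update s.profile i (addUnit z t)⟩ t := by
  have hi : G.CanImprove s.demand s.profile i := ⟨_, ht, (privateCost_lt_iff hz).2 hlt⟩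
  have hpos := h.others_pos ((canImprove_iff (hF.base i)).1 hi)
  have hy := h.optAt_reinsert hpos hz ht hmin
  refine ⟨AlgStep.whileStep s i _ hi (isBestResponse_iff.2 hy) ?_, h.move hpos hz hy⟩
  rw [hz]
  refine hamming_addUnit_addUnit z ?_
  rintro rfl
  exact lt_irrefl _ hlt

/-- A player who has no improving move of a unit on the marked resource cannot improve. -/
theorem Marked.not_canImprove {s : AlgState N R} {r : R} (h : G.Marked s r) (hF : G.Feasible s)
    {i : N} (hi : ∀ z, s.profile i = addUnit z r → ∀ q,
      addUnit z q ∈ (G.f i).base (s.demand i) →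
      G.inc i r (others s.profile i r + z r) (z r) ≤
        G.inc i q (others s.profile i q + z q) (z q)) :
    ¬ G.CanImprove s.demand s.profile i := by
  intro hc
  obtain ⟨z, p, q, hz, hq, hlt⟩ := exists_addUnit_of_canImprove hF hc
  obtain rfl := h.eq_of_lt hz hq hlt
  exact absurd (hi z hz q hq) (not_le.2 hlt)

theorem isPureNash_of_returns {s : AlgState N R} (hF : G.Feasible s)
    (hopt : ∀ j, ¬ G.CanImprove s.demand s.profile j) (hd : s.demand = G.demand) :
    G.IsPureNash s.profile := by
  intro i
  rw [isBestResponse_iff, ← hd]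
  exact hF.optAt (hopt i)

/-- If somebody can improve, the cheapest reinsertion of a unit from the mark is a legal move.
Otherwise either all demands are met, or some demand is short and the rank leaves room for a
cheapest insertion. -/
theorem AlgRun.progress {s : AlgState N R} {T : ℕ} (h : G.AlgRun T s) :
    (G.AlgReturns s ∧ G.IsPureNash s.profile) ∨
      (¬ G.AlgReturns s ∧ ∃ s', G.AlgStep s s') := by
  obtain ⟨hF, hT⟩ := h.inv
  by_cases hc : ∃ j, G.CanImprove s.demand s.profile j
  · refine Or.inr ⟨fun hr => hr.2 hc, ?_⟩
    obtain ⟨i, hi⟩ := hc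
    rcases hT with ⟨rfl, -⟩ | ⟨r, hM, -⟩
    · exact absurd hi (not_canImprove_init i)
    obtain ⟨z, p, q, hz, hq, hlt⟩ := exists_addUnit_of_canImprove hF hi
    obtain rfl := hM.eq_of_lt hz hq hlt
    obtain ⟨t, ht, hmin⟩ := exists_min_insert (a := others s.profile i) ⟨q, hq⟩
    exact ⟨_, (hM.algStep_move hF hz ht hmin ((hmin q hq).trans_lt hlt)).1⟩
  · push Not at hc
    by_cases hk : s.k = ∑ j, G.demand j
    · refine Or.inl ⟨⟨hk, fun ⟨j, hj⟩ => hc j hj⟩, isPureNash_of_returns hF hc ?_⟩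
      rw [← hF.sum] at hk
      exact funext fun i => (Finset.sum_eq_sum_iff_of_le fun j _ => hF.le j).1 hk i
        (Finset.mem_univ i)
    · refine Or.inr ⟨fun hr => hk hr.1, ?_⟩
      obtain ⟨i, hi⟩ : ∃ i, s.demand i < G.demand i := by
        by_contra! hcon
        refine hk ?_
        rw [← hF.sum]
        exact Finset.sum_congr rfl fun i _ => le_antisymm (hF.le i) (hcon i)
      obtain ⟨r, hr, hmin⟩ := exists_min_insert (a := others s.profile i)
        (exists_augment (hF.base i) (hi.trans_le (G.demand_le i)))
      exact ⟨_, (algStep_insert hF hc hi hr hmin).1⟩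

end

end PolymatroidGame

/-! ### Random access machines: bit lengths, time, total correctness -/

section

variable {n m : ℕ} (G : PolymatroidGame (Fin n) (Fin m))

/-- All cost queries that are made when the expression is evaluated are at loads that do not exceed
the total demand. -/
def RamExpr.Safe (μ : RamMem) : RamExpr → Prop
  | .lit _ => True
  | .get _ j => j.Safe μ
  | .add e₁ e₂ => e₁.Safe μ ∧ e₂.Safe μ
  | .sub e₁ e₂ => e₁.Safe μ ∧ e₂.Safe μ
  | .mul e₁ e₂ => e₁.Safe μ ∧ e₂.Safe μ
  | .rank i _ => i.Safe μ
  | .cost i r x => (i.Safe μ ∧ r.Safe μ ∧ x.Safe μ) ∧ x.val G μ ≤ ∑ j, G.demand j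

/-- An upper bound for the size and the literals of an expression. -/
def RamExpr.weight : RamExpr → ℕ
  | .lit v => v + 1
  | .get _ j => j.weight + 1
  | .add e₁ e₂ => e₁.weight + e₂.weight + 1
  | .sub e₁ e₂ => e₁.weight + e₂.weight + 1
  | .mul e₁ e₂ => e₁.weight + e₂.weight + 1
  | .rank i _ => i.weight + 1
  | .cost i r x => i.weight + r.weight + x.weight + 1

/-- The value of the expression is computed without multiplication. -/
def RamExpr.Additive : RamExpr → Prop
  | .add e₁ e₂ => e₁.Additive ∧ e₂.Additive
  | .sub e₁ e₂ => e₁.Additive ∧ e₂.Additive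
  | .mul _ _ => False
  | _ => True

/-- An upper bound for the weights of the expressions in a program. -/
def RamProg.weight : RamProg → ℕ
  | .skip => 0
  | .assign _ j e => j.weight + e.weight
  | .seq p q => p.weight + q.weight
  | .ite e p q => e.weight + p.weight + q.weight
  | .loop e p => e.weight + p.weight

/-- All values that the program stores are computed without multiplication. -/
def RamProg.Additive : RamProg → Prop
  | .skip => True
  | .assign _ _ e => e.Additive
  | .seq p q => p.Additive ∧ q.Additive
  | .ite _ p q => p.Additive ∧ q.Additive
  | .loop _ p => p.Additive

/-- The arrays that a program may modify. -/
def RamProg.writes : RamProg → List ℕ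
  | .skip => []
  | .assign a _ _ => [a]
  | .seq p q => p.writes ++ q.writes
  | .ite _ p q => p.writes ++ q.writes
  | .loop _ p => p.writes

/-- All entries of the memory have at most `B` bits. -/
def RamMem.Bounded (μ : RamMem) (B : ℕ) : Prop := ∀ a j, μ a j < 2 ^ B

theorem RamMem.Bounded.mono {μ : RamMem} {B C : ℕ} (h : μ.Bounded B) (hBC : B ≤ C) :
    μ.Bounded C :=
  fun a j => (h a j).trans_le (Nat.pow_le_pow_right (by norm_num) hBC)

theorem rankOracle_lt (i : ℕ) (A : ℕ → ℕ) : rankOracle G i A < 2 ^ G.maxBits := by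
  unfold rankOracle
  split_ifs with h
  · rw [← Nat.size_le]
    refine le_trans ?_ (le_max_left _ _)
    refine le_trans ?_ (Finset.le_sup (Finset.mem_univ (⟨i, h⟩ : Fin n)))
    exact Finset.le_sup (f := fun U : Finset (Fin m) => Nat.size ((G.f ⟨i, h⟩).rank U))
      (Finset.mem_univ _)
  · positivity

theorem costOracle_lt (i r : ℕ) {x : ℕ} (hx : x ≤ ∑ j, G.demand j) :
    costOracle G i r x < 2 ^ G.maxBits := by
  unfold costOracle
  split_ifs with h
  · rw [← Nat.size_le]
    refine le_trans ?_ (le_max_right _ _)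
    refine le_trans ?_ (Finset.le_sup (Finset.mem_univ (⟨i, h.1⟩ : Fin n)))
    refine le_trans ?_ (Finset.le_sup (Finset.mem_univ (⟨r, h.2⟩ : Fin m)))
    exact Finset.le_sup (f := fun x => Nat.size (G.c ⟨i, h.1⟩ ⟨r, h.2⟩ x))
      (Finset.mem_range.2 (by omega))
  · positivity

variable {G}

theorem two_pow_le {a b : ℕ} (h : a ≤ b) : 2 ^ a ≤ 2 ^ b := Nat.pow_le_pow_right (by norm_num) h

/-- Bit lengths add under products and grow by at most one under sums, hence the factor `weight`.
Products occur in addresses and conditions, whose values are never stored. -/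
theorem RamExpr.val_lt {μ : RamMem} {B : ℕ} (hB : G.maxBits ≤ B) (hB1 : 1 ≤ B)
    (hμ : μ.Bounded B) (e : RamExpr) (he : e.Safe G μ) : e.val G μ < 2 ^ (B * e.weight) := by
  have hBw : ∀ w, B ≤ B * (w + 1) := fun w => Nat.le_mul_of_pos_right _ (Nat.succ_pos w)
  induction e with
  | lit v =>
    refine Nat.lt_two_pow_self.trans_le (two_pow_le ?_)
    simp only [RamExpr.weight, RamExpr.val]
    nlinarith
  | get a j ih => exact (hμ a _).trans_le (two_pow_le (hBw _))
  | add e₁ e₂ ih₁ ih₂ =>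
    have h1 := ih₁ he.1
    have h2 := ih₂ he.2
    simp only [RamExpr.val, RamExpr.weight]
    have h3 : 2 ^ (B * e₁.weight) ≤ 2 ^ (B * (e₁.weight + e₂.weight)) :=
      two_pow_le (Nat.mul_le_mul_left _ (by omega))
    have h4 : 2 ^ (B * e₂.weight) ≤ 2 ^ (B * (e₁.weight + e₂.weight)) :=
      two_pow_le (Nat.mul_le_mul_left _ (by omega))
    have h5 : 2 ^ (B * (e₁.weight + e₂.weight) + 1) ≤ 2 ^ (B * (e₁.weight + e₂.weight + 1)) :=
      two_pow_le (by rw [Nat.mul_succ]; omega)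
    rw [pow_succ] at h5
    omega
  | sub e₁ e₂ ih₁ ih₂ =>
    have h1 := ih₁ he.1
    simp only [RamExpr.val, RamExpr.weight]
    have h3 : 2 ^ (B * e₁.weight) ≤ 2 ^ (B * (e₁.weight + e₂.weight + 1)) :=
      two_pow_le (Nat.mul_le_mul_left _ (by omega))
    omega
  | mul e₁ e₂ ih₁ ih₂ =>
    have h1 := ih₁ he.1
    have h2 := ih₂ he.2
    simp only [RamExpr.val, RamExpr.weight]
    calc _ < 2 ^ (B * e₁.weight) * 2 ^ (B * e₂.weight) := Nat.mul_lt_mul'' h1 h2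
      _ = 2 ^ (B * (e₁.weight + e₂.weight)) := by rw [← pow_add, Nat.mul_add]
      _ ≤ _ := two_pow_le (Nat.mul_le_mul_left _ (by omega))
  | rank i a ih =>
    exact (rankOracle_lt G _ _).trans_le (two_pow_le (hB.trans (hBw _)))
  | cost i r x =>
    exact (costOracle_lt G _ _ he.2).trans_le (two_pow_le (hB.trans (hBw _)))

/-- For stored values the weight enters as a summand, not as a factor. Over a run the bit lengths
therefore grow linearly instead of exponentially. -/
theorem RamExpr.Additive.val_lt {μ : RamMem} {B : ℕ} (hB : G.maxBits ≤ B) (hμ : μ.Bounded B)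
    {e : RamExpr} (ha : e.Additive) (he : e.Safe G μ) : e.val G μ < 2 ^ (B + e.weight) := by
  induction e with
  | lit v => exact Nat.lt_two_pow_self.trans_le (two_pow_le (by
    simp only [RamExpr.weight, RamExpr.val]; omega))
  | get a j ih => exact (hμ a _).trans_le (two_pow_le (by omega))
  | add e₁ e₂ ih₁ ih₂ =>
    have h1 := ih₁ ha.1 he.1
    have h2 := ih₂ ha.2 he.2
    simp only [RamExpr.val, RamExpr.weight]
    have h3 : 2 ^ (B + e₁.weight) ≤ 2 ^ (B + (e₁.weight + e₂.weight)) := two_pow_le (by omega)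
    have h4 : 2 ^ (B + e₂.weight) ≤ 2 ^ (B + (e₁.weight + e₂.weight)) := two_pow_le (by omega)
    rw [← Nat.add_assoc, pow_succ]
    omega
  | sub e₁ e₂ ih₁ ih₂ =>
    have h1 := ih₁ ha.1 he.1
    simp only [RamExpr.val, RamExpr.weight]
    have h3 : 2 ^ (B + e₁.weight) ≤ 2 ^ (B + (e₁.weight + e₂.weight + 1)) :=
      two_pow_le (by omega)
    omega
  | mul e₁ e₂ ih₁ ih₂ => exact ha.elim
  | rank i a ih => exact (rankOracle_lt G _ _).trans_le (two_pow_le (by omega))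
  | cost i r x => exact (costOracle_lt G _ _ he.2).trans_le (two_pow_le (by omega))

theorem RamExpr.time_le {μ : RamMem} {B W : ℕ} (hB : G.maxBits ≤ B) (hB1 : 1 ≤ B)
    (hμ : μ.Bounded B) (e : RamExpr) (he : e.Safe G μ) (hW : e.weight ≤ W) :
    e.time G μ ≤ e.weight * (1 + B * W + m) := by
  have hs : ∀ e : RamExpr, e.Safe G μ → e.weight ≤ W → Nat.size (e.val G μ) ≤ B * W := by
    intro e he hW
    rw [Nat.size_le]
    exact (e.val_lt hB hB1 hμ he).trans_le (two_pow_le (Nat.mul_le_mul_left _ hW))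
  have h0 := hs e he hW
  induction e with
  | lit v =>
    simp only [RamExpr.time, RamExpr.weight, RamExpr.val] at *
    nlinarith
  | get a j ih =>
    have h1 := ih he (by simp only [RamExpr.weight] at hW; omega)
      (hs _ he (by simp only [RamExpr.weight] at hW; omega))
    simp only [RamExpr.time, RamExpr.weight, Nat.add_mul] at *
    omega
  | add e₁ e₂ ih₁ ih₂ =>
    simp only [RamExpr.weight] at hW
    have h1 := ih₁ he.1 (by omega) (hs _ he.1 (by omega))
    have h2 := ih₂ he.2 (by omega) (hs _ he.2 (by omega))
    simp only [RamExpr.time, RamExpr.weight, Nat.add_mul] at *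
    omega
  | sub e₁ e₂ ih₁ ih₂ =>
    simp only [RamExpr.weight] at hW
    have h1 := ih₁ he.1 (by omega) (hs _ he.1 (by omega))
    have h2 := ih₂ he.2 (by omega) (hs _ he.2 (by omega))
    simp only [RamExpr.time, RamExpr.weight, Nat.add_mul] at *
    omega
  | mul e₁ e₂ ih₁ ih₂ =>
    simp only [RamExpr.weight] at hW
    have h1 := ih₁ he.1 (by omega) (hs _ he.1 (by omega))
    have h2 := ih₂ he.2 (by omega) (hs _ he.2 (by omega))
    simp only [RamExpr.time, RamExpr.weight, Nat.add_mul] at *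
    omega
  | rank i a ih =>
    have h1 := ih he (by simp only [RamExpr.weight] at hW; omega)
      (hs _ he (by simp only [RamExpr.weight] at hW; omega))
    simp only [RamExpr.time, RamExpr.weight, Nat.add_mul] at *
    omega
  | cost i r x ih₁ ih₂ ih₃ =>
    simp only [RamExpr.weight] at hW
    have h1 := ih₁ he.1.1 (by omega) (hs _ he.1.1 (by omega))
    have h2 := ih₂ he.1.2.1 (by omega) (hs _ he.1.2.1 (by omega))
    have h3 := ih₃ he.1.2.2 (by omega) (hs _ he.1.2.2 (by omega))
    simp only [RamExpr.time, RamExpr.weight, Nat.add_mul] at *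
    omega

variable (G)

/-- `RamRuns G p μ s μ'`: the program `p` started in memory `μ` halts after `s` instructions in
memory `μ'`, and all cost queries are at loads that do not exceed the total demand. -/
inductive RamRuns : RamProg → RamMem → ℕ → RamMem → Prop
  | skip (μ : RamMem) : RamRuns .skip μ 1 μ
  | assign {μ : RamMem} {a : ℕ} {j e : RamExpr} (hj : j.Safe G μ) (he : e.Safe G μ) :
      RamRuns (.assign a j e) μ 1 (μ.write a (j.val G μ) (e.val G μ))
  | seq {p q : RamProg} {μ μ' μ'' : RamMem} {s s' : ℕ}
      (h : RamRuns p μ s μ') (h' : RamRuns q μ' s' μ'') :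
      RamRuns (.seq p q) μ (s + s' + 1) μ''
  | ite_true {e : RamExpr} {p q : RamProg} {μ μ' : RamMem} {s : ℕ} (hs : e.Safe G μ)
      (he : e.val G μ ≠ 0) (h : RamRuns p μ s μ') : RamRuns (.ite e p q) μ (s + 1) μ'
  | ite_false {e : RamExpr} {p q : RamProg} {μ μ' : RamMem} {s : ℕ} (hs : e.Safe G μ)
      (he : e.val G μ = 0) (h : RamRuns q μ s μ') : RamRuns (.ite e p q) μ (s + 1) μ'
  | loop_true {e : RamExpr} {p : RamProg} {μ μ' μ'' : RamMem} {s s' : ℕ} (hs : e.Safe G μ)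
      (he : e.val G μ ≠ 0) (h : RamRuns p μ s μ') (h' : RamRuns (.loop e p) μ' s' μ'') :
      RamRuns (.loop e p) μ (s + s' + 1) μ''
  | loop_false {e : RamExpr} {p : RamProg} {μ : RamMem} (hs : e.Safe G μ)
      (he : e.val G μ = 0) : RamRuns (.loop e p) μ 1 μ

variable {G}

theorem RamMem.Bounded.write {μ : RamMem} {B : ℕ} (h : μ.Bounded B) {a j v : ℕ}
    (hv : v < 2 ^ B) : (μ.write a j v).Bounded B := by
  intro b k
  unfold RamMem.write
  by_cases hb : b = a
  · subst hb
    rw [Function.update_self]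
    by_cases hk : k = j
    · subst hk
      rwa [Function.update_self]
    · rw [Function.update_of_ne hk]
      exact h _ _
  · rw [Function.update_of_ne hb]
    exact h _ _

/-- A run of `s` instructions of a program that stores no products takes time polynomial in `s`
and in the bit lengths at the start. -/
theorem RamRuns.exists_exec {p : RamProg} {μ μ' : RamMem} {s W C : ℕ} (h : RamRuns G p μ s μ')
    (ha : p.Additive) (hW : p.weight ≤ W) {B : ℕ} (hB : G.maxBits ≤ B) (hB1 : 1 ≤ B)
    (hμ : μ.Bounded B) (hC : B + s * W ≤ C) :
    ∃ t, RamExec G p μ t μ' ∧ t ≤ s * (W * (1 + C * W + m) + 1) ∧ μ'.Bounded (B + s * W) := by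
  -- `C` bounds the bit lengths throughout the run, so one time bound serves all instructions.
  have htime : ∀ (e : RamExpr) (ν : RamMem), e.Safe G ν → ν.Bounded C → e.weight ≤ W →
      e.time G ν ≤ e.weight * (1 + C * W + m) := fun e ν he hν hw =>
    e.time_le (by omega) (by omega) hν he hw
  generalize hK : 1 + C * W + m = K at *
  have hwt : ∀ w, w ≤ W → w * K ≤ W * K := fun w hw => Nat.mul_le_mul_right _ hw
  induction h generalizing B with
  | skip μ => exact ⟨1, .skip μ, by nlinarith [Nat.zero_le (W * K)], hμ.mono (by omega)⟩
  | @assign μ a j e hj he =>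
    simp only [RamProg.weight] at hW
    have h1 := htime j μ hj (hμ.mono (by omega)) (by omega)
    have h2 := htime e μ he (hμ.mono (by omega)) (by omega)
    have h3 := hwt _ hW
    rw [Nat.add_mul] at h3
    refine ⟨_, .assign μ a j e, by omega, (hμ.mono (by omega)).write ?_⟩
    exact (RamExpr.Additive.val_lt hB hμ ha he).trans_le (two_pow_le (by omega))
  | @seq p q μ μ' μ'' s s' h h' ih ih' =>
    simp only [RamProg.weight] at hW
    have e1 : (s + s' + 1) * W = s * W + s' * W + W := by ring
    obtain ⟨t, h1, h2, h3⟩ := ih ha.1 (by omega) hB hB1 hμ (by omega)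
    obtain ⟨t', h1', h2', h3'⟩ := ih' ha.2 (by omega) (B := B + s * W) (by omega) (by omega) h3
      (by omega)
    refine ⟨_, .seq h1 h1', ?_, h3'.mono (by omega)⟩
    simp only [Nat.add_mul] at *
    omega
  | @ite_true e p q μ μ' s hs he h ih =>
    simp only [RamProg.weight] at hW
    have e1 : (s + 1) * W = s * W + W := by ring
    obtain ⟨t, h1, h2, h3⟩ := ih ha.1 (by omega) hB hB1 hμ (by omega)
    have h4 := htime e μ hs (hμ.mono (by omega)) (by omega)
    have h5 := hwt e.weight (by omega)
    refine ⟨_, .ite_true he h1, ?_, h3.mono (by omega)⟩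
    simp only [Nat.add_mul] at *
    omega
  | @ite_false e p q μ μ' s hs he h ih =>
    simp only [RamProg.weight] at hW
    have e1 : (s + 1) * W = s * W + W := by ring
    obtain ⟨t, h1, h2, h3⟩ := ih ha.2 (by omega) hB hB1 hμ (by omega)
    have h4 := htime e μ hs (hμ.mono (by omega)) (by omega)
    have h5 := hwt e.weight (by omega)
    refine ⟨_, .ite_false he h1, ?_, h3.mono (by omega)⟩
    simp only [Nat.add_mul] at *
    omega
  | @loop_true e p μ μ' μ'' s s' hs he h h' ih ih' =>
    have hW' := hW
    simp only [RamProg.weight] at hW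
    have e1 : (s + s' + 1) * W = s * W + s' * W + W := by ring
    obtain ⟨t, h1, h2, h3⟩ := ih ha (by omega) hB hB1 hμ (by omega)
    obtain ⟨t', h1', h2', h3'⟩ := ih' ha hW' (B := B + s * W) (by omega) (by omega) h3 (by omega)
    have h4 := htime e μ hs (hμ.mono (by omega)) (by omega)
    have h5 := hwt e.weight (by omega)
    refine ⟨_, .loop_true he h1 h1', ?_, h3'.mono (by omega)⟩
    simp only [Nat.add_mul] at *
    omega
  | @loop_false e p μ hs he =>
    simp only [RamProg.weight] at hW
    have h4 := htime e μ hs (hμ.mono (by omega)) (by omega)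
    have h5 := hwt e.weight (by omega)
    refine ⟨_, .loop_false he, by omega, hμ.mono (by omega)⟩

theorem RamRuns.frame {p : RamProg} {μ μ' : RamMem} {s : ℕ} (h : RamRuns G p μ s μ') {a : ℕ}
    (ha : a ∉ p.writes) : μ' a = μ a := by
  induction h with
  | skip | loop_false => rfl
  | @assign μ b j e =>
    simp only [RamProg.writes, List.mem_singleton] at ha
    exact Function.update_of_ne ha _ _
  | seq _ _ ih ih' =>
    simp only [RamProg.writes, List.mem_append, not_or] at ha
    rw [ih' ha.2, ih ha.1]
  | ite_true _ _ _ ih =>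
    simp only [RamProg.writes, List.mem_append, not_or] at ha
    exact ih ha.1
  | ite_false _ _ _ ih =>
    simp only [RamProg.writes, List.mem_append, not_or] at ha
    exact ih ha.2
  | loop_true _ _ _ _ ih ih' => rw [ih' ha, ih ha]

variable (G)

/-- Total correctness: the program halts, and `Q` holds for the final memory and for the number
of instructions, added to `c`. -/
def RamProg.Wp (p : RamProg) (μ : RamMem) (c : ℕ) (Q : RamMem → ℕ → Prop) : Prop :=
  ∃ s μ', RamRuns G p μ s μ' ∧ Q μ' (c + s)

variable {G}

theorem RamProg.Wp.mono {p : RamProg} {μ : RamMem} {c : ℕ} {Q Q' : RamMem → ℕ → Prop}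
    (h : p.Wp G μ c Q)
    (hQ : ∀ μ' c', (∀ a, a ∉ p.writes → μ' a = μ a) → Q μ' c' → Q' μ' c') : p.Wp G μ c Q' := by
  obtain ⟨s, μ', h1, h2⟩ := h
  exact ⟨s, μ', h1, hQ _ _ (fun a ha => h1.frame ha) h2⟩

theorem RamProg.wp_assign {a : ℕ} {j e : RamExpr} {μ : RamMem} {c : ℕ}
    {Q : RamMem → ℕ → Prop} (hj : j.Safe G μ) (he : e.Safe G μ)
    (h : Q (μ.write a (j.val G μ) (e.val G μ)) (c + 1)) : (RamProg.assign a j e).Wp G μ c Q :=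
  ⟨1, _, .assign hj he, h⟩

theorem RamProg.wp_seq {p q : RamProg} {μ : RamMem} {c : ℕ} {Q : RamMem → ℕ → Prop}
    (h : p.Wp G μ c fun μ' c' => q.Wp G μ' (c' + 1) Q) : (RamProg.seq p q).Wp G μ c Q := by
  obtain ⟨s, μ', h1, s', μ'', h2, h3⟩ := h
  refine ⟨_, _, .seq h1 h2, ?_⟩
  rwa [show c + (s + s' + 1) = c + s + 1 + s' by omega]

theorem RamProg.wp_assign_seq {a : ℕ} {j e : RamExpr} {q : RamProg} {μ : RamMem} {c : ℕ}
    {Q : RamMem → ℕ → Prop} (hj : j.Safe G μ) (he : e.Safe G μ)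
    (h : q.Wp G (μ.write a (j.val G μ) (e.val G μ)) (c + 2) Q) :
    (RamProg.seq (.assign a j e) q).Wp G μ c Q :=
  wp_seq (wp_assign hj he h)

theorem RamProg.wp_skip {μ : RamMem} {c : ℕ} {Q : RamMem → ℕ → Prop} (h : Q μ (c + 1)) :
    RamProg.skip.Wp G μ c Q :=
  ⟨1, _, .skip μ, h⟩

theorem RamProg.wp_ite {e : RamExpr} {p q : RamProg} {μ : RamMem} {c : ℕ}
    {Q : RamMem → ℕ → Prop} (hs : e.Safe G μ) (h1 : e.val G μ ≠ 0 → p.Wp G μ (c + 1) Q)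
    (h2 : e.val G μ = 0 → q.Wp G μ (c + 1) Q) : (RamProg.ite e p q).Wp G μ c Q := by
  by_cases he : e.val G μ = 0
  · obtain ⟨s, μ', h3, h4⟩ := h2 he
    exact ⟨_, _, .ite_false hs he h3, by rwa [show c + (s + 1) = c + 1 + s by omega]⟩
  · obtain ⟨s, μ', h3, h4⟩ := h1 he
    exact ⟨_, _, .ite_true hs he h3, by rwa [show c + (s + 1) = c + 1 + s by omega]⟩

/-- The rule for loops, where `k` in `I k` is an upper bound for the number of iterations. -/
theorem RamProg.wp_loop {e : RamExpr} {p : RamProg} (I : ℕ → RamMem → Prop) (b : ℕ)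
    (hs : ∀ k μ, I k μ → e.Safe G μ)
    (hI : ∀ k μ c, I k μ → e.val G μ ≠ 0 →
      p.Wp G μ c fun μ' c' => (∃ k' < k, I k' μ') ∧ c' ≤ c + b)
    {k c : ℕ} {μ : RamMem} (h : I k μ) {Q : RamMem → ℕ → Prop}
    (hQ : ∀ k' μ' c', I k' μ' → e.val G μ' = 0 → c' ≤ c + k * (b + 1) + 1 → Q μ' c') :
    (RamProg.loop e p).Wp G μ c Q := by
  induction k using Nat.strong_induction_on generalizing μ c with
  | _ k ih =>
    by_cases he : e.val G μ = 0
    · exact ⟨1, μ, .loop_false (hs k μ h) he, hQ k μ _ h he (by omega)⟩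
    · obtain ⟨s, μ', h1, ⟨k', hk', h2⟩, h3⟩ := hI k μ c h he
      obtain ⟨s', μ'', h4, h5⟩ := ih k' hk' (c := c + s + 1) h2 (fun l ν c' hl hν hc => by
        refine hQ l ν c' hl hν ?_
        have : (k' + 1) * (b + 1) ≤ k * (b + 1) := Nat.mul_le_mul_right _ hk'
        rw [Nat.add_mul] at this
        omega)
      exact ⟨_, _, .loop_true (hs k μ h) he h1 h4,
        by rwa [show c + (s + s' + 1) = c + s + 1 + s' by omega]⟩

/-- The variable with the number `a`, which is entry `0` of array `a`. -/
abbrev RamExpr.var (a : ℕ) : RamExpr := .get a (.lit 0)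

/-- `for v < e do p` -/
def RamProg.forLoop (v : ℕ) (e : RamExpr) (p : RamProg) : RamProg :=
  .seq (.assign v (.lit 0) (.lit 0))
    (.loop (.sub e (.var v)) (.seq p (.assign v (.lit 0) (.add (.var v) (.lit 1)))))

/-- The bound `e` is evaluated anew in every round, so the invariant has to fix its value. The
overhead is three instructions per round and three in total for the initialization and the final
test. -/
theorem RamProg.wp_forLoop {v : ℕ} {e : RamExpr} {p : RamProg} (I : ℕ → RamMem → Prop)
    (K b : ℕ) {μ : RamMem} {c : ℕ} {Q : RamMem → ℕ → Prop}
    (he : ∀ k μ, I k μ → e.Safe G μ ∧ e.val G μ = K)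
    (hI : ∀ k μ c, k < K → I k μ → μ v 0 = k →
      p.Wp G μ c fun μ' c' => (μ' v 0 = k ∧ I (k + 1) (μ'.write v 0 (k + 1))) ∧ c' ≤ c + b)
    (h : I 0 (μ.write v 0 0))
    (hQ : ∀ μ' c', I K μ' → μ' v 0 = K → c' ≤ c + K * (b + 3) + 3 → Q μ' c') :
    (RamProg.forLoop v e p).Wp G μ c Q := by
  have hw : ∀ (ν : RamMem) (x : ℕ), ν.write v 0 x v 0 = x := fun ν x => by simp [RamMem.write]
  refine wp_assign_seq trivial trivial ?_
  refine wp_loop (fun j ν => ∃ k ≤ K, j = K - k ∧ I k ν ∧ ν v 0 = k) (b + 2) ?_ ?_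
    (k := K) ⟨0, Nat.zero_le _, rfl, h, hw _ _⟩ ?_
  · rintro _ ν ⟨k, -, -, h1, -⟩
    exact ⟨(he k ν h1).1, trivial⟩
  · rintro _ ν c ⟨k, hk, rfl, h1, h2⟩ hne
    simp only [RamExpr.val, (he k ν h1).2, h2] at hne
    have hkK : k < K := by omega
    refine wp_seq ((hI k ν c hkK h1 h2).mono ?_)
    rintro ν' c' - ⟨⟨h3, h4⟩, h5⟩
    refine wp_assign trivial ⟨trivial, trivial⟩ ⟨⟨K - (k + 1), by omega, k + 1, hkK, rfl, ?_⟩, by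
      omega⟩
    simp only [RamExpr.val, h3]
    exact ⟨h4, hw _ _⟩
  · rintro _ ν c' ⟨k, hk, rfl, h1, h2⟩ h3 h4
    simp only [RamExpr.val, (he k ν h1).2, h2] at h3
    obtain rfl : k = K := by omega
    exact hQ ν c' h1 h2 (by nlinarith)

end

@[simp] theorem RamMem.write_same (μ : RamMem) (a j v : ℕ) :
    μ.write a j v a = Function.update (μ a) j v := Function.update_self _ _ _

@[simp] theorem RamMem.write_of_ne (μ : RamMem) {a b : ℕ} (j v : ℕ) (h : b ≠ a) :
    μ.write a j v b = μ b := Function.update_of_ne h _ _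

/-! ### Enumerating the subsets of a support by binary numbers -/

/-- Successive quotients of `t` by two, one for every `s` with `g s ≠ 0`. -/
def halve (g : ℕ → ℕ) (t : ℕ) : ℕ → ℕ
  | 0 => t
  | s + 1 => if g s ≠ 0 then halve g t s / 2 else halve g t s

/-- The subset of the support of `g` whose members correspond to the binary digits of `t`. -/
def Selected (g : ℕ → ℕ) (t s : ℕ) : Prop := g s ≠ 0 ∧ halve g t s % 2 ≠ 0

instance (g : ℕ → ℕ) (t s : ℕ) : Decidable (Selected g t s) := by
  unfold Selected
  infer_instance

theorem halve_le (g : ℕ → ℕ) (t s : ℕ) : halve g t s ≤ t := by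
  induction s with
  | zero => exact le_rfl
  | succ s ih =>
    simp only [halve]
    split_ifs <;> omega

theorem halve_succ_left (g : ℕ → ℕ) (t s : ℕ) :
    halve g t (s + 1) = halve (fun s => g (s + 1)) (if g 0 ≠ 0 then t / 2 else t) s := by
  induction s with
  | zero => rfl
  | succ s ih => rw [halve, ih, halve]

/-- Every subset of the support is selected by a number with as many digits as the support has
members. -/
theorem exists_selected (g : ℕ → ℕ) (U : ℕ → Prop) (m : ℕ) :
    ∃ t < 2 ^ (∑ s ∈ Finset.range m, g s), ∀ s < m, Selected g t s ↔ g s ≠ 0 ∧ U s := by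
  induction m generalizing g U with
  | zero => exact ⟨0, by simp, by simp⟩
  | succ m ih =>
    obtain ⟨t, ht, hsel⟩ := ih (fun s => g (s + 1)) (fun s => U (s + 1))
    rw [Finset.sum_range_succ']
    by_cases h0 : g 0 = 0
    · refine ⟨t, by simpa [h0] using ht, fun s hs => ?_⟩
      rcases s with _ | s
      · simp [Selected, h0]
      · rw [← hsel s (by omega), Selected, Selected, halve_succ_left]
        simp [h0]
    · have hpow : 2 ^ (∑ s ∈ Finset.range m, g (s + 1)) * 2 ≤
          2 ^ (∑ s ∈ Finset.range m, g (s + 1) + g 0) := by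
        rw [← pow_succ]
        exact two_pow_le (by omega)
      -- If `0` is in the support, the lowest digit `b` decides about it and `t` about the rest; `g
      -- 0 ≥ 1` pays for the extra digit.
      have key : ∀ b < 2, (b ≠ 0 ↔ U 0) → ∃ t < 2 ^ (∑ s ∈ Finset.range m, g (s + 1) + g 0),
          ∀ s < m + 1, Selected g t s ↔ g s ≠ 0 ∧ U s := by
        intro b hb hU
        refine ⟨2 * t + b, by omega, fun s hs => ?_⟩
        rcases s with _ | s
        · have h1 : (2 * t + b) % 2 = b := by omega
          simp only [Selected, halve, h1, hU]
        · have h1 : (2 * t + b) / 2 = t := by omega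
          rw [← hsel s (by omega), Selected, Selected, halve_succ_left, if_pos h0, h1]
      by_cases hU : U 0
      · exact key 1 (by omega) (by simp [hU])
      · exact key 0 (by omega) (by simp [hU])

section

variable {n m : ℕ} {G : PolymatroidGame (Fin n) (Fin m)}

theorem rankOracle_congr {i : ℕ} {A A' : ℕ → ℕ} (h : ∀ r < m, A r ≠ 0 ↔ A' r ≠ 0) :
    rankOracle G i A = rankOracle G i A' := by
  unfold rankOracle
  split_ifs with hi
  · congr 1
    ext r
    simpa only [Finset.mem_filter, Finset.mem_univ, true_and] using h r r.2
  · rfl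

/-- Subsets of the support suffice for testing independence. -/
theorem indep_iff_selected (i : Fin n) (g : ℕ → ℕ) {d : ℕ}
    (hd : ∑ s ∈ Finset.range m, g s ≤ d) :
    (∀ t < 2 ^ d, ∑ s ∈ Finset.range m, (if Selected g t s then g s else 0) ≤
      rankOracle G i fun s => if Selected g t s then 1 else 0) ↔
    ∀ U : Finset (Fin m), ∑ r ∈ U, g r ≤ (G.f i).rank U := by
  have hval : ∀ t, (∑ s ∈ Finset.range m, (if Selected g t s then g s else 0) ≤
      rankOracle G i fun s => if Selected g t s then 1 else 0) ↔
      ∑ r ∈ Finset.univ.filter (fun r : Fin m => Selected g t r), g r ≤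
        (G.f i).rank (Finset.univ.filter fun r : Fin m => Selected g t r) := by
    intro t
    rw [Finset.sum_range (fun s => if Selected g t s then g s else 0), Finset.sum_filter]
    simp [rankOracle]
  simp only [hval]
  constructor
  · intro h U
    obtain ⟨t, ht, hsel⟩ := exists_selected g (fun s => ∃ h : s < m, (⟨s, h⟩ : Fin m) ∈ U) m
    have h1 := h t (ht.trans_le (two_pow_le hd))
    -- Intersecting `U` with the support keeps the sum and does not raise the rank.
    have h2 : Finset.univ.filter (fun r : Fin m => Selected g t r) =
        U.filter fun r : Fin m => g r ≠ 0 := by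
      ext r
      simp [hsel r r.2, and_comm]
    rw [h2, Finset.sum_filter_ne_zero] at h1
    exact h1.trans ((G.f i).monotone _ _ (Finset.filter_subset _ _))
  · exact fun h t _ => h _

end

/-! ### The independence test -/

namespace RamProg

open RamExpr

/-- The position of player `p` and resource `r` in the matrix that is stored in array `2`. -/
def address (p r : RamExpr) : RamExpr := .add (.mul p (.get 0 (.lit 1))) r

/-- The entry of player `p` and resource `r` in the matrix that is stored in array `2`. -/
def entry (p r : RamExpr) : RamExpr := .get 2 (address p r)

/-- Decodes one digit for resource `var 17`: array `18` holds the subset, `var 16` its load and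
`var 15` the remaining digits. -/
def decodeStep : RamProg :=
  .seq (.assign 18 (var 17) (.lit 0)) <|
  .ite (entry (var 7) (var 17))
    (.seq
      (.ite (.get 20 (var 15))
        (.seq (.assign 18 (var 17) (.lit 1))
          (.assign 16 (.lit 0) (.add (var 16) (entry (var 7) (var 17)))))
        .skip)
      (.assign 15 (.lit 0) (.get 19 (var 15))))
    .skip

/-- Tests the rank constraint of player `var 7` for the subset with the number `var 13`. -/
def testSubset : RamProg :=
  .seq (.assign 15 (.lit 0) (var 13)) <|
  .seq (.assign 16 (.lit 0) (.lit 0)) <|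
  .seq (.forLoop 17 (.get 0 (.lit 1)) decodeStep) <|
  .ite (.sub (var 16) (.rank (var 7) 18)) (.assign 12 (.lit 0) (.lit 0)) .skip

/-- Sets `var 14` to two to the power of the demand of player `var 7`, and fills arrays `19` and
`20` with the quotients and the remainders of the smaller numbers by two. -/
def prepareTables : RamProg :=
  .seq (.assign 14 (.lit 0) (.lit 1)) <|
  .seq (.forLoop 21 (.get 1 (var 7)) (.assign 14 (.lit 0) (.add (var 14) (var 14)))) <|
  .seq (.assign 19 (.lit 0) (.lit 0)) <|
  .seq (.assign 19 (.lit 1) (.lit 0)) <|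
  .seq (.assign 20 (.lit 0) (.lit 0)) <|
  .seq (.assign 20 (.lit 1) (.lit 1)) <|
  -- The machine has no division: from `h` to `h + 2` the quotient by two grows by one and the
  -- remainder stays.
  .forLoop 21 (var 14)
    (.seq (.assign 19 (.add (var 21) (.lit 2)) (.add (.get 19 (var 21)) (.lit 1)))
      (.assign 20 (.add (var 21) (.lit 2)) (.get 20 (var 21))))

/-- Sets `var 12` to a nonzero value if and only if the row of player `var 7` satisfies the rank
constraints. -/
def checkIndep : RamProg :=
  .seq prepareTables <|
  .seq (.assign 12 (.lit 0) (.lit 1)) <|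
  .forLoop 13 (var 14) testSubset

section

variable {n m : ℕ} {G : PolymatroidGame (Fin n) (Fin m)}

theorem wp_testSubset {μ : RamMem} {c i t : ℕ} {g : ℕ → ℕ} (hm : μ 0 1 = m) (hi : μ 7 0 = i)
    (ht : μ 13 0 = t) (hg : ∀ s, μ 2 (i * m + s) = g s)
    (htab : ∀ h ≤ t, μ 19 h = h / 2 ∧ μ 20 h = h % 2) :
    testSubset.Wp G μ c fun μ' c' => c' ≤ c + (m * 15 + 12) ∧ μ' 12 0 =
      if ∑ s ∈ Finset.range m, (if Selected g t s then g s else 0) ≤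
        rankOracle G i (fun s => if Selected g t s then 1 else 0) then μ 12 0 else 0 := by
  refine wp_assign_seq trivial trivial (wp_assign_seq trivial trivial (wp_seq ?_))
  refine wp_forLoop (fun s ν => (ν 0 = μ 0 ∧ ν 2 = μ 2 ∧ ν 7 = μ 7 ∧ ν 12 = μ 12 ∧
    ν 19 = μ 19 ∧ ν 20 = μ 20) ∧ ν 15 0 = halve g t s ∧
    ν 16 0 = ∑ s ∈ Finset.range s, (if Selected g t s then g s else 0) ∧
    ∀ r < s, ν 18 r = if Selected g t r then 1 else 0) m 12 ?_ ?_ ?_ ?_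
  · rintro k ν ⟨⟨h0, -⟩, -⟩
    exact ⟨trivial, by simp [RamExpr.val, h0, hm]⟩
  · rintro k ν c hk ⟨⟨h0, h2, h7, h12, h19, h20⟩, h15, h16, h18⟩ h17
    have hcell : (entry (var 7) (var 17)).val G ν = g k := by
      simp [entry, address, RamExpr.val, h0, h2, h7, h17, hi, hm, hg]
    have h15le : ν 15 0 ≤ t := h15 ▸ halve_le g t k
    have hh := htab _ h15le
    refine wp_assign_seq trivial trivial (wp_ite (by simp [entry, address, RamExpr.Safe]) ?_ ?_)
    · intro hne
      have hne' : g k ≠ 0 := by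
        simpa [entry, address, RamExpr.val, h0, h2, h7, h17, hi, hm, hg] using hne
      refine wp_seq (wp_ite trivial ?_ ?_)
      · intro hb
        have hb' : ν 15 0 % 2 ≠ 0 := by simpa [RamExpr.val, h20, hh] using hb
        have hsel : Selected g t k := ⟨hne', by rwa [← h15]⟩
        refine wp_assign_seq trivial trivial (wp_assign trivial
          (by simp [entry, address, RamExpr.Safe]) (wp_assign trivial trivial ?_))
        refine ⟨⟨by simpa [RamExpr.val] using h17, ⟨by simp [RamExpr.val, h0, h2, h7, h12, h19, h20],
          ?_, ?_, ?_⟩⟩, by omega⟩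
        · simp [RamExpr.val, h19, hh, halve, hne', ← h15]
        · simp [entry, address, RamExpr.val, h0, h2, h7, h17, hi, hm, hg, h16, Finset.sum_range_succ, hsel]
        · intro r hr
          by_cases hrk : r = k
          · subst hrk
            simp [RamExpr.val, h17, hsel]
          · simp [RamExpr.val, h17, hrk, h18 r (by omega)]
      · intro hb
        have hb' : ν 15 0 % 2 = 0 := by simpa [RamExpr.val, h20, hh] using hb
        have hsel : ¬ Selected g t k := fun h => h.2 (by rwa [← h15])
        refine wp_skip (wp_assign trivial trivial ?_)
        refine ⟨⟨by simpa [RamExpr.val] using h17, ⟨by simp [RamExpr.val, h0, h2, h7, h12, h19, h20],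
          ?_, ?_, ?_⟩⟩, by omega⟩
        · simp [RamExpr.val, h19, hh, halve, hne', ← h15]
        · simp [RamExpr.val, h16, Finset.sum_range_succ, hsel]
        · intro r hr
          by_cases hrk : r = k
          · subst hrk
            simp [RamExpr.val, h17, hsel]
          · simp [RamExpr.val, h17, hrk, h18 r (by omega)]
    · intro he
      have he' : g k = 0 := by
        simpa [entry, address, RamExpr.val, h0, h2, h7, h17, hi, hm, hg] using he
      have hsel : ¬ Selected g t k := fun h => h.1 he'
      refine wp_skip ?_
      refine ⟨⟨by simpa [RamExpr.val] using h17, ⟨by simp [RamExpr.val, h0, h2, h7, h12, h19, h20],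
        ?_, ?_, ?_⟩⟩, by omega⟩
      · simp [RamExpr.val, halve, he', ← h15]
      · simp [RamExpr.val, h16, Finset.sum_range_succ, hsel]
      · intro r hr
        by_cases hrk : r = k
        · subst hrk
          simp [RamExpr.val, h17, hsel]
        · simp [RamExpr.val, h17, hrk, h18 r (by omega)]
  · simp [RamExpr.val, ht, halve]
  · rintro ν c' ⟨⟨h0, h2, h7, h12, h19, h20⟩, h15, h16, h18⟩ h17 hc'
    -- Entries of array `18` from `m` on may be stale, but the oracle does not read them.
    have hr : rankOracle G i (ν 18) =
        rankOracle G i (fun s => if Selected g t s then 1 else 0) :=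
      rankOracle_congr fun r hr => by rw [h18 r hr]
    refine wp_ite ⟨trivial, trivial⟩ ?_ ?_
    · intro hne
      simp only [RamExpr.val, h16, h7, hi, hr] at hne
      refine wp_assign trivial trivial ⟨by omega, ?_⟩
      rw [if_neg (by omega)]
      simp [RamExpr.val]
    · intro he
      simp only [RamExpr.val, h16, h7, hi, hr] at he
      refine wp_skip ⟨by omega, ?_⟩
      rw [if_pos (by omega), h12]

theorem wp_prepareTables {μ : RamMem} {c i d : ℕ} (hi : μ 7 0 = i) (hd : μ 1 i = d) :
    prepareTables.Wp G μ c fun μ' c' => c' ≤ c + (d * 4 + 2 ^ d * 6 + 20) ∧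
      μ' 14 0 = 2 ^ d ∧ ∀ h < 2 ^ d, μ' 19 h = h / 2 ∧ μ' 20 h = h % 2 := by
  refine wp_assign_seq trivial trivial (wp_seq ?_)
  refine wp_forLoop (fun k ν => ν 1 = μ 1 ∧ ν 7 = μ 7 ∧ ν 14 0 = 2 ^ k) d 1 ?_ ?_ ?_ ?_
  · rintro k ν ⟨h1, h7, -⟩
    exact ⟨trivial, by simp [RamExpr.val, h1, h7, hi, hd]⟩
  · rintro k ν c hk ⟨h1, h7, h14⟩ h21
    refine wp_assign trivial ⟨trivial, trivial⟩ ⟨⟨by simpa using h21, ?_⟩, le_rfl⟩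
    simp [RamExpr.val, h1, h7, h14, pow_succ, mul_two]
  · simp [RamExpr.val]
  rintro ν c' ⟨-, -, h14⟩ - hc'
  refine wp_assign_seq trivial trivial (wp_assign_seq trivial trivial
    (wp_assign_seq trivial trivial (wp_assign_seq trivial trivial ?_)))
  -- The tables run two entries ahead of the counter, which the initial entries `0` and `1` provide.
  refine wp_forLoop (fun k ν => ν 14 0 = 2 ^ d ∧
    ∀ h < k + 2, ν 19 h = h / 2 ∧ ν 20 h = h % 2) (2 ^ d) 3 ?_ ?_ ?_ ?_
  · rintro k ν ⟨h14, -⟩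
    exact ⟨trivial, by simp [RamExpr.val, h14]⟩
  · rintro k ν c hk ⟨h14, htab⟩ h21
    refine wp_assign_seq ⟨trivial, trivial⟩ ⟨trivial, trivial⟩
      (wp_assign ⟨trivial, trivial⟩ trivial ⟨⟨by simpa using h21, by simpa using h14, ?_⟩, le_rfl⟩)
    intro h hh
    have h1 := htab k (by omega)
    by_cases hk2 : h = k + 2
    · subst hk2
      simp [RamExpr.val, h21, h1]
    · have := htab h (by omega)
      simp [RamExpr.val, h21, hk2, this]
  · refine ⟨by simpa [RamExpr.val] using h14, fun h hh => ?_⟩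
    rcases h with _ | _ | h
    · simp [RamExpr.val]
    · simp [RamExpr.val]
    · omega
  · rintro ν c' ⟨h14, htab⟩ - hc'
    exact ⟨by omega, h14, fun h hh => htab h (by omega)⟩

theorem wp_checkIndep {μ : RamMem} {c d : ℕ} {i : Fin n} {g : ℕ → ℕ} (hm : μ 0 1 = m)
    (hi : μ 7 0 = i) (hd : μ 1 i = d) (hg : ∀ s, μ 2 (i * m + s) = g s)
    (hgd : ∑ s ∈ Finset.range m, g s ≤ d) :
    checkIndep.Wp G μ c fun μ' c' => c' ≤ c + (d * 4 + 2 ^ d * (m * 15 + 21) + 30) ∧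
      (μ' 12 0 ≠ 0 ↔ ∀ U : Finset (Fin m), ∑ r ∈ U, g r ≤ (G.f i).rank U) := by
  rw [← indep_iff_selected i g hgd]
  refine wp_seq ((wp_prepareTables hi hd).mono ?_)
  rintro ν c' hf ⟨hc', h14, htab⟩
  have hw : prepareTables.writes = [14, 21, 14, 21, 19, 19, 20, 20, 21, 19, 20, 21] := rfl
  rw [hw] at hf
  have f0 := hf 0 (by decide)
  have f2 := hf 2 (by decide)
  have f7 := hf 7 (by decide)
  refine wp_assign_seq trivial trivial ?_
  refine wp_forLoop (fun k ξ => (ξ 0 = ν 0 ∧ ξ 2 = ν 2 ∧ ξ 7 = ν 7 ∧ ξ 14 = ν 14 ∧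
    ξ 19 = ν 19 ∧ ξ 20 = ν 20) ∧ (ξ 12 0 ≠ 0 ↔ ∀ t < k,
      ∑ s ∈ Finset.range m, (if Selected g t s then g s else 0) ≤
      rankOracle G i fun s => if Selected g t s then 1 else 0)) (2 ^ d) (m * 15 + 12) ?_ ?_ ?_ ?_
  · rintro k ξ ⟨⟨-, -, -, h, -⟩, -⟩
    exact ⟨trivial, by simp [RamExpr.val, h, h14]⟩
  · rintro k ξ c hk ⟨⟨h0, h2, h7, h14', h19, h20⟩, h12⟩ h13
    refine (wp_testSubset (i := i) (t := k) (g := g) (by rw [h0, f0, hm]) (by rw [h7, f7, hi]) h13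
      (fun s => by rw [h2, f2, hg]) (fun h hh => by rw [h19, h20]; exact htab h (by omega))).mono ?_
    rintro ξ' c' hf' ⟨hc', h12'⟩
    have hw' : testSubset.writes = [15, 16, 17, 18, 18, 16, 15, 17, 12] := rfl
    rw [hw'] at hf'
    refine ⟨⟨by rw [hf' 13 (by decide), h13], ?_, ?_⟩, hc'⟩
    · simp [hf', h0, h2, h7, h14', h19, h20]
    · rw [RamMem.write_of_ne _ _ _ (by decide), h12', Nat.forall_lt_succ_right]
      split_ifs with h
      · rw [h12]
        simp [h]
      · simp [h]
  · simp [RamExpr.val]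
  · rintro ξ c'' ⟨-, h⟩ - hc''
    refine ⟨?_, h⟩
    have e1 : 2 ^ d * (m * 15 + 21) = 2 ^ d * (m * 15 + 12 + 3) + 2 ^ d * 6 := by ring
    omega

end

end RamProg

/-! ### Representation of a profile in the memory -/

namespace PolymatroidGame

section

variable {n m : ℕ} (G : PolymatroidGame (Fin n) (Fin m))

/-- The increase of the cost as a natural number. -/
def natInc (i : Fin n) (r : Fin m) (L k : ℕ) : ℕ := G.c i r (L + 1) * (k + 1) - G.c i r L * k

/-- Monotone costs make the truncated subtraction exact, so the machine can compute increments in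
`ℕ`. -/
theorem coe_natInc (i : Fin n) (r : Fin m) (L k : ℕ) : (G.natInc i r L k : ℤ) = G.inc i r L k := by
  have h : G.c i r L * k ≤ G.c i r (L + 1) * (k + 1) :=
    Nat.mul_le_mul (G.cost_mono i r (Nat.le_succ L)) (Nat.le_succ k)
  unfold natInc inc
  rw [Nat.cast_sub h]
  push_cast
  rfl

/-- The memory holds the input, the strategies `x` in array `2` and the loads in array `3`. -/
structure Represents (μ : RamMem) (x : Fin n → Fin m → ℕ) : Prop where
  players : μ 0 0 = n
  resources : μ 0 1 = m
  demand : ∀ i : Fin n, μ 1 i = G.demand i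
  profile : ∀ (i : Fin n) (r : Fin m), μ 2 (i * m + r) = x i r
  load : ∀ r : Fin m, μ 3 r = ∑ j, x j r

variable {G}

theorem Represents.congr {μ ν : RamMem} {x : Fin n → Fin m → ℕ} (h : G.Represents μ x)
    (hν : ∀ a < 4, ν a = μ a) : G.Represents ν x where
  players := by rw [hν 0 (by decide), h.players]
  resources := by rw [hν 0 (by decide), h.resources]
  demand i := by rw [hν 1 (by decide), h.demand]
  profile i r := by rw [hν 2 (by decide), h.profile]
  load r := by rw [hν 3 (by decide), h.load]

theorem address_inj {i j : ℕ} {r t : Fin m} (h : i * m + r = j * m + t) : i = j ∧ r = t := by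
  have hm : 0 < m := r.pos
  rw [Nat.mul_comm i, Nat.mul_comm j] at h
  have h1 := congrArg (· / m) h
  have h2 := congrArg (· % m) h
  simp only [Nat.mul_add_div hm, Nat.mul_add_mod,
    Nat.div_eq_of_lt r.2, Nat.div_eq_of_lt t.2, Nat.mod_eq_of_lt r.2, Nat.mod_eq_of_lt t.2] at h1 h2
  exact ⟨by omega, Fin.ext h2⟩

theorem Represents.update {μ ν : RamMem} {x : Fin n → Fin m → ℕ} (h : G.Represents μ x)
    {i : Fin n} {r : Fin m} {y : Fin m → ℕ} (hy : ∀ t, t ≠ r → y t = x i t)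
    (h0 : ν 0 = μ 0) (h1 : ν 1 = μ 1) (h2 : ν 2 = Function.update (μ 2) (i * m + r) (y r))
    (h3 : ν 3 = Function.update (μ 3) r (others x i r + y r)) :
    G.Represents ν (Function.update x i y) where
  players := by rw [h0, h.players]
  resources := by rw [h0, h.resources]
  demand j := by rw [h1, h.demand]
  profile j t := by
    rw [h2]
    by_cases hjt : (j : ℕ) * m + t = i * m + r
    · obtain ⟨hj, rfl⟩ := address_inj hjt
      obtain rfl := Fin.ext hj
      simp
    · rw [Function.update_of_ne hjt, h.profile]
      by_cases hj : j = i
      · subst hj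
        rw [Function.update_self, hy t]
        rintro rfl
        exact hjt rfl
      · rw [Function.update_of_ne hj]
  load t := by
    rw [h3, load_update]
    by_cases ht : t = r
    · subst ht
      simp
    · rw [Function.update_of_ne (fun h => ht (Fin.ext h)), h.load, load_eq x i, hy t ht]

/-- As player `i` still has a unit to place, a cost query at the load plus one stays in the range
that `maxBits` covers. -/
theorem load_lt {x : Fin n → Fin m → ℕ} {i : Fin n} (hx : ∀ j, ∑ r, x j r ≤ G.demand j)
    (hi : ∑ r, x i r + 1 ≤ G.demand i) (r : Fin m) :
    ∑ j, x j r + 1 ≤ ∑ j, G.demand j := by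
  have h1 : ∀ j, x j r ≤ ∑ r, x j r := fun j =>
    Finset.single_le_sum (f := x j) (fun _ _ => Nat.zero_le _) (Finset.mem_univ r)
  have h2 : ∑ j, x j r < ∑ j, G.demand j :=
    Finset.sum_lt_sum (fun j _ => (h1 j).trans (hx j))
      ⟨i, Finset.mem_univ i, by have := h1 i; omega⟩
  omega

end

end PolymatroidGame

/-! ### The program, and the search for a cheapest insertion -/

namespace RamProg

open RamExpr PolymatroidGame

/-- The increase of the cost of player `p` when a unit is added on resource `r`. -/
def increase (p r : RamExpr) : RamExpr :=
  .sub (.mul (.cost p r (.add (.get 3 r) (.lit 1))) (.add (entry p r) (.lit 1)))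
    (.mul (.cost p r (.get 3 r)) (entry p r))

/-- Compares resource `var 9` with the best resource `var 10` that has been found so far. -/
def findStep : RamProg :=
  .seq (.assign 2 (address (var 7) (var 9)) (.add (entry (var 7) (var 9)) (.lit 1))) <|
  .seq checkIndep <|
  .seq (.assign 2 (address (var 7) (var 9)) (.sub (entry (var 7) (var 9)) (.lit 1))) <|
  .ite (var 12)
    (.ite (var 11)
      (.ite (.sub (increase (var 7) (var 10)) (increase (var 7) (var 9)))
        (.assign 10 (.lit 0) (var 9)) .skip)
      (.seq (.assign 11 (.lit 0) (.lit 1)) (.assign 10 (.lit 0) (var 9))))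
    .skip

/-- Sets `var 10` to a resource on which player `var 7` can add a unit at the least cost. -/
def findBest : RamProg :=
  .seq (.assign 11 (.lit 0) (.lit 0)) (.forLoop 9 (.get 0 (.lit 1)) findStep)

/-- Adds a unit of player `p` on resource `r`. -/
def place (p r : RamExpr) : RamProg :=
  .seq (.assign 2 (address p r) (.add (entry p r) (.lit 1)))
    (.assign 3 r (.add (.get 3 r) (.lit 1)))

/-- Removes a unit of player `p` on resource `r`. -/
def remove (p r : RamExpr) : RamProg :=
  .seq (.assign 2 (address p r) (.sub (entry p r) (.lit 1)))
    (.assign 3 r (.sub (.get 3 r) (.lit 1)))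

/-- Lets player `var 6` move a unit away from the marked resource `var 8` if this is an
improvement, and turns to the next player otherwise. -/
def improveStep : RamProg :=
  .ite (entry (var 6) (var 8))
    (.seq (remove (var 6) (var 8)) <|
      .seq (.assign 7 (.lit 0) (var 6)) <|
      .seq findBest <|
      .ite (.sub (increase (var 7) (var 8)) (increase (var 7) (var 10)))
        (.seq (place (var 6) (var 10)) <|
          .seq (.assign 8 (.lit 0) (var 10)) (.assign 6 (.lit 0) (.lit 0)))
        (.seq (place (var 6) (var 8)) (.assign 6 (.lit 0) (.add (var 6) (.lit 1)))))
    (.assign 6 (.lit 0) (.add (var 6) (.lit 1)))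

/-- Adds a unit of demand to player `var 4`, and restores the equilibrium. -/
def addStep : RamProg :=
  .seq (.assign 7 (.lit 0) (var 4)) <|
  .seq findBest <|
  .seq (place (var 4) (var 10)) <|
  .seq (.assign 8 (.lit 0) (var 10)) <|
  .seq (.assign 6 (.lit 0) (.lit 0)) <|
  .loop (.sub (.get 0 (.lit 0)) (var 6)) improveStep

/-- The program that computes a pure Nash equilibrium. -/
def computeNash : RamProg :=
  .forLoop 4 (.get 0 (.lit 0)) (.forLoop 5 (.get 1 (var 4)) addStep)

theorem additive_computeNash : computeNash.Additive := by
  simp [computeNash, addStep, improveStep, place, remove, findBest, findStep, checkIndep,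
    prepareTables, testSubset, decodeStep, forLoop, entry, RamProg.Additive, RamExpr.Additive]

/-- A bound for the number of instructions of `checkIndep`, where `E` is two to the power of the
maximum demand `D`. -/
def checkBound {A : Type*} [CommSemiring A] (m D E : A) : A := D * 4 + E * (m * 15 + 21) + 30

/-- A bound for the number of instructions of `findBest`. -/
def findBound {A : Type*} [CommSemiring A] (m D E : A) : A := m * (checkBound m D E + 20) + 6

/-- A bound for the number of iterations of the algorithm. -/
def iterBound {A : Type*} [CommSemiring A] (n m D : A) : A := n * D * (n * m * D ^ 2)

/-- A bound for the number of instructions of `addStep`. -/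
def addBound {A : Type*} [CommSemiring A] (n m D E : A) : A :=
  findBound m D E + (n * iterBound n m D + n) * (findBound m D E + 41) + 40

/-- A bound for the number of instructions of `computeNash`. -/
def nashBound {A : Type*} [CommSemiring A] (n m D E : A) : A :=
  n * (D * (addBound n m D E + 3) + 6) + 3

section

variable {n m : ℕ} {G : PolymatroidGame (Fin n) (Fin m)}

theorem increase_spec {μ : RamMem} {x : Fin n → Fin m → ℕ} (h : G.Represents μ x) {i : Fin n}
    (hx : ∀ j, ∑ r, x j r ≤ G.demand j) (hi : ∑ r, x i r + 1 ≤ G.demand i) {a b : ℕ} {q : Fin m}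
    (ha : μ a 0 = i) (hb : μ b 0 = q) :
    (increase (var a) (var b)).Safe G μ ∧
      (increase (var a) (var b)).val G μ = G.natInc i q (∑ j, x j q) (x i q) := by
  have h1 := load_lt hx hi q
  constructor
  · simp [increase, RamExpr.Safe, RamExpr.val, entry, address, hb, h.load]
    omega
  · simp [increase, RamExpr.val, entry, address, ha, hb, h.load, h.resources, h.profile,
      costOracle, natInc]

theorem wp_findStep {μ : RamMem} {c : ℕ} {x : Fin n → Fin m → ℕ} (h : G.Represents μ x)
    {i : Fin n} (hx : ∀ j, ∑ r, x j r ≤ G.demand j) (hi : ∑ r, x i r + 1 ≤ G.demand i)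
    (h7 : μ 7 0 = i) {q : Fin m} (h9 : μ 9 0 = q) {F : Fin m → Prop}
    (hF : ∀ q, F q ↔ ∀ U : Finset (Fin m), ∑ r ∈ U, addUnit (x i) q r ≤ (G.f i).rank U)
    (h10 : μ 11 0 ≠ 0 → ∃ t : Fin m, μ 10 0 = t) :
    findStep.Wp G μ c fun μ' c' => c' ≤ c + (checkBound m G.maxDemand (2 ^ G.maxDemand) + 17) ∧
      (∀ a < 10, μ' a = μ a) ∧
      (¬ F q → μ' 10 = μ 10 ∧ μ' 11 = μ 11) ∧
      (F q → μ' 11 0 ≠ 0) ∧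
      (F q → μ 11 0 = 0 → μ' 10 0 = q) ∧
      (F q → ∀ t : Fin m, μ 11 0 ≠ 0 → μ 10 0 = t →
        μ' 10 0 = if G.natInc i q (∑ j, x j q) (x i q) < G.natInc i t (∑ j, x j t) (x i t)
          then q else t) := by
  have hadd : ∀ ν : RamMem, ν 0 1 = m → ν 7 0 = i → ν 9 0 = q →
      (address (var 7) (var 9)).val G ν = i * m + q := by
    intro ν e0 e7 e9
    simp [address, RamExpr.val, e0, e7, e9]
  refine wp_assign_seq (by simp [address, RamExpr.Safe]) (by simp [entry, address, RamExpr.Safe])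
    (wp_seq ?_)
  rw [hadd μ h.resources h7 h9]
  have hv : (RamExpr.add (entry (var 7) (var 9)) (.lit 1)).val G μ = x i q + 1 := by
    simp [entry, address, RamExpr.val, h.resources, h7, h9, h.profile]
  rw [hv]
  set ν := μ.write 2 (i * m + q) (x i q + 1) with hν
  have hrow : ∀ r : Fin m, ν 2 (i * m + r) = addUnit (x i) q r := by
    intro r
    by_cases hr : r = q
    · subst hr
      simp [hν]
    · rw [hν, RamMem.write_same, Function.update_of_ne, h.profile, addUnit_of_ne _ hr]
      intro he
      exact hr (address_inj he).2
  -- With the tentative unit the row still sums to at most the demand, as the test by `2 ^ d`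
  -- subsets requires.
  have hsum : ∑ s ∈ Finset.range m, ν 2 (i * m + s) = ∑ r, x i r + 1 := by
    rw [Finset.sum_range fun s => ν 2 (i * m + s)]
    simp only [hrow]
    exact univ_sum_addUnit _ _
  have hdem : G.demand i ≤ G.maxDemand := Finset.le_sup (f := G.demand) (Finset.mem_univ i)
  refine (wp_checkIndep (d := G.demand i) (i := i) (g := fun s => ν 2 (i * m + s))
    (by simpa [hν] using h.resources) (by simpa [hν] using h7)
    (by simpa [hν] using h.demand i) (fun s => rfl) (by rw [hsum]; exact hi)).mono ?_
  rintro ξ c' hf ⟨hc', h12⟩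
  simp only [hrow] at h12
  rw [← hF q] at h12
  have hc'' : c' ≤ c + 2 + checkBound m G.maxDemand (2 ^ G.maxDemand) := by
    refine hc'.trans (Nat.add_le_add_left ?_ _)
    unfold checkBound
    gcongr
    norm_num
  have hf' : ∀ a ∉ checkIndep.writes, ξ a = ν a := hf
  have hw : checkIndep.writes = [14, 21, 14, 21, 19, 19, 20, 20, 21, 19, 20, 21, 12, 13,
    15, 16, 17, 18, 18, 16, 15, 17, 12, 13] := rfl
  rw [hw] at hf'
  refine wp_assign_seq (by simp [address, RamExpr.Safe]) (by simp [entry, address, RamExpr.Safe]) ?_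
  have g0 : ξ 0 = μ 0 := by rw [hf' 0 (by decide)]; simp [hν]
  have g2 : ξ 2 = ν 2 := hf' 2 (by decide)
  have g7 : ξ 7 = μ 7 := by rw [hf' 7 (by decide)]; simp [hν]
  have g9 : ξ 9 = μ 9 := by rw [hf' 9 (by decide)]; simp [hν]
  rw [hadd ξ (by rw [g0, h.resources]) (by rw [g7, h7]) (by rw [g9, h9])]
  have hv' : (RamExpr.sub (entry (var 7) (var 9)) (.lit 1)).val G ξ = x i q := by
    have : (entry (var 7) (var 9)).val G ξ = x i q + 1 := by
      rw [entry, RamExpr.val, hadd ξ (by rw [g0, h.resources]) (by rw [g7, h7]) (by rw [g9, h9]),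
        g2, hrow]
      simp
    simp only [RamExpr.val, this]
    omega
  rw [hv']
  set ρ := ξ.write 2 (i * m + q) (x i q) with hρ
  -- The tentative unit is gone again, so the matrix and the control variables are as before.
  have hρa : ∀ a < 12, ρ a = μ a := by
    intro a ha
    by_cases ha2 : a = 2
    · subst ha2
      rw [hρ, RamMem.write_same, g2, hν, RamMem.write_same, Function.update_idem, ← h.profile,
        Function.update_eq_self]
    · rw [hρ, RamMem.write_of_ne _ _ _ ha2, hf' a (by simp; omega), hν,
        RamMem.write_of_ne _ _ _ ha2]
  have hρ12 : ρ 12 0 ≠ 0 ↔ F q := by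
    rw [hρ, RamMem.write_of_ne _ _ _ (by decide), h12]
  have hrep : G.Represents ρ x := h.congr fun a ha => hρa a (by omega)
  have r7 : ρ 7 0 = i := by rw [hρa 7 (by decide), h7]
  have r9 : ρ 9 0 = q := by rw [hρa 9 (by decide), h9]
  have r10 := hρa 10 (by decide)
  have r11 := hρa 11 (by decide)
  clear_value ρ
  refine wp_ite trivial (fun hok => ?_) (fun hok => ?_)
  · have hFq : F q := hρ12.1 hok
    refine wp_ite trivial (fun hhas => ?_) (fun hhas => ?_)
    · have hhas' : μ 11 0 ≠ 0 := by rw [← r11]; exact hhas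
      obtain ⟨t, ht⟩ := h10 hhas'
      have s1 := increase_spec hrep hx hi r7 r9
      have s2 := increase_spec hrep hx hi r7 (show ρ 10 0 = t by rw [r10, ht])
      refine wp_ite ⟨s2.1, s1.1⟩ (fun hlt => ?_) (fun hge => ?_)
      · rw [RamExpr.val, s1.2, s2.2] at hlt
        refine wp_assign trivial trivial ⟨by omega, ?_, fun hn => absurd hFq hn, fun _ => ?_,
          fun _ h0 => absurd h0 hhas', fun _ t' _ ht' => ?_⟩
        · intro a ha
          rw [RamMem.write_of_ne _ _ _ (by omega), hρa a (by omega)]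
        · simpa [r11] using hhas'
        · obtain rfl : t = t' := Fin.ext (ht.symm.trans ht')
          rw [if_pos (by omega)]
          simp [RamExpr.val, r9]
      · rw [RamExpr.val, s1.2, s2.2] at hge
        refine wp_skip ⟨by omega, fun a ha => hρa a (by omega), fun hn => absurd hFq hn,
          fun _ => by rwa [r11], fun _ h0 => absurd h0 hhas', fun _ t' _ ht' => ?_⟩
        obtain rfl : t = t' := Fin.ext (ht.symm.trans ht')
        rw [if_neg (by omega), r10, ht]
    · have hhas' : μ 11 0 = 0 := by rw [← r11]; exact hhas
      refine wp_assign_seq trivial trivial (wp_assign trivial trivial ⟨by omega, ?_,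
        fun hn => absurd hFq hn, fun _ => by simp [RamExpr.val], fun _ _ => by simp [RamExpr.val, r9],
        fun _ _ h0 => absurd hhas' h0⟩)
      intro a ha
      rw [RamMem.write_of_ne _ _ _ (by omega), RamMem.write_of_ne _ _ _ (by omega),
        hρa a (by omega)]
  · have hFq : ¬ F q := fun h => hρ12.2 h hok
    exact wp_skip ⟨by omega, fun a ha => hρa a (by omega), fun _ => ⟨r10, r11⟩,
      fun h => absurd h hFq, fun h => absurd h hFq, fun h => absurd h hFq⟩

theorem wp_findBest {μ : RamMem} {c : ℕ} {x : Fin n → Fin m → ℕ} (h : G.Represents μ x)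
    {i : Fin n} (hx : ∀ j, ∑ r, x j r ≤ G.demand j) (h7 : μ 7 0 = i) {d : ℕ}
    (hsum : ∑ r, x i r + 1 = d) (hi : d ≤ G.demand i)
    (hex : ∃ q, addUnit (x i) q ∈ (G.f i).base d) :
    findBest.Wp G μ c fun μ' c' => c' ≤ c + findBound m G.maxDemand (2 ^ G.maxDemand) ∧
      (∀ a < 9, μ' a = μ a) ∧ ∃ t : Fin m, μ' 10 0 = t ∧ addUnit (x i) t ∈ (G.f i).base d ∧
        ∀ q, addUnit (x i) q ∈ (G.f i).base d →
          G.natInc i t (∑ j, x j t) (x i t) ≤ G.natInc i q (∑ j, x j q) (x i q) := by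
  set F : Fin m → Prop := fun q => addUnit (x i) q ∈ (G.f i).base d with hFdef
  set C : Fin m → ℕ := fun q => G.natInc i q (∑ j, x j q) (x i q) with hC
  have hF : ∀ q, F q ↔ ∀ U : Finset (Fin m), ∑ r ∈ U, addUnit (x i) q r ≤ (G.f i).rank U :=
    fun q => ⟨fun h => h.1, fun h => ⟨h, by rw [univ_sum_addUnit, hsum]⟩⟩
  refine wp_assign_seq trivial trivial ?_
  -- Variable `11` tells whether a feasible resource has been seen; if so, variable `10` is a
  -- cheapest one among the first `k`.
  refine wp_forLoop (fun k ν => (∀ a < 9, ν a = μ a) ∧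
    (ν 11 0 = 0 → ∀ q : Fin m, (q : ℕ) < k → ¬ F q) ∧
    (ν 11 0 ≠ 0 → ∃ t : Fin m, ν 10 0 = t ∧ F t ∧ ∀ q : Fin m, (q : ℕ) < k → F q → C t ≤ C q))
    m (checkBound m G.maxDemand (2 ^ G.maxDemand) + 17) ?_ ?_ ?_ ?_
  · rintro k ν ⟨h0, -⟩
    exact ⟨trivial, by simp [RamExpr.val, h0, h.resources]⟩
  · rintro k ν c hk ⟨hf, hno, hyes⟩ h9
    refine (wp_findStep (q := ⟨k, hk⟩) (h.congr fun a ha => hf a (by omega)) hx (by omega)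
      (by rw [hf 7 (by decide), h7]) h9 hF
      (fun h => (hyes h).imp fun t ht => ht.1)).mono ?_
    rintro ν' c' hfr ⟨hc', hf', h1, h2, h3, h4⟩
    refine ⟨⟨by rw [hf' 9 (by decide), h9], ?_, ?_, ?_⟩, hc'⟩
    · intro a ha
      rw [RamMem.write_of_ne _ _ _ (by omega), hf' a (by omega), hf a ha]
    · rw [RamMem.write_of_ne _ _ _ (by decide)]
      intro h0 q hq
      have hFk : ¬ F ⟨k, hk⟩ := fun h => h2 h h0
      rw [(h1 hFk).2] at h0
      rcases Nat.lt_succ_iff_lt_or_eq.1 hq with hq | hq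
      · exact hno h0 q hq
      · obtain rfl : q = ⟨k, hk⟩ := Fin.ext hq
        exact hFk
    · rw [RamMem.write_of_ne _ _ _ (by decide), RamMem.write_of_ne _ _ _ (by decide)]
      intro h0
      by_cases hFk : F ⟨k, hk⟩
      · by_cases h11 : ν 11 0 = 0
        · refine ⟨⟨k, hk⟩, h3 hFk h11, hFk, fun q hq hFq => ?_⟩
          rcases Nat.lt_succ_iff_lt_or_eq.1 hq with hq | hq
          · exact absurd hFq (hno h11 q hq)
          · obtain rfl : q = ⟨k, hk⟩ := Fin.ext hq
            exact le_rfl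
        · obtain ⟨t, ht, hFt, hmin⟩ := hyes h11
          have h5 := h4 hFk t h11 ht
          by_cases hlt : C ⟨k, hk⟩ < C t
          · rw [if_pos hlt] at h5
            refine ⟨⟨k, hk⟩, h5, hFk, fun q hq hFq => ?_⟩
            rcases Nat.lt_succ_iff_lt_or_eq.1 hq with hq | hq
            · exact hlt.le.trans (hmin q hq hFq)
            · obtain rfl : q = ⟨k, hk⟩ := Fin.ext hq
              exact le_rfl
          · rw [if_neg hlt] at h5
            refine ⟨t, h5, hFt, fun q hq hFq => ?_⟩
            rcases Nat.lt_succ_iff_lt_or_eq.1 hq with hq | hq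
            · exact hmin q hq hFq
            · obtain rfl : q = ⟨k, hk⟩ := Fin.ext hq
              exact not_lt.1 hlt
      · rw [(h1 hFk).2] at h0
        obtain ⟨t, ht, hFt, hmin⟩ := hyes h0
        refine ⟨t, by rw [(h1 hFk).1, ht], hFt, fun q hq hFq => ?_⟩
        rcases Nat.lt_succ_iff_lt_or_eq.1 hq with hq | hq
        · exact hmin q hq hFq
        · obtain rfl : q = ⟨k, hk⟩ := Fin.ext hq
          exact absurd hFq hFk
  · refine ⟨fun a ha => ?_, fun _ q hq => absurd hq (Nat.not_lt_zero _), fun h0 => ?_⟩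
    · rw [RamMem.write_of_ne _ _ _ (by omega), RamMem.write_of_ne _ _ _ (by omega)]
    · simp [RamExpr.val] at h0
  · rintro ν c' ⟨hf, hno, hyes⟩ - hc'
    rw [Nat.add_assoc (checkBound _ _ _), show 17 + 3 = 20 from rfl] at hc'
    refine ⟨by unfold findBound; omega, hf, ?_⟩
    obtain ⟨q, hq⟩ := hex
    obtain ⟨t, ht, hFt, hmin⟩ := hyes fun h0 => hno h0 q q.2 hq
    exact ⟨t, ht, hFt, fun q hq => hmin q q.2 hq⟩

end

end RamProg

/-! ### Simulation of the algorithm and the polynomial bound -/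

namespace RamProg

open RamExpr PolymatroidGame

section

variable {n m : ℕ} {G : PolymatroidGame (Fin n) (Fin m)}

theorem wp_place {μ : RamMem} {c a b : ℕ} {x : Fin n → Fin m → ℕ} (h : G.Represents μ x)
    {i : Fin n} {r : Fin m} (ha : μ a 0 = i) (hb : μ b 0 = r) (hb2 : b ≠ 2) :
    (place (var a) (var b)).Wp G μ c fun μ' c' => c' ≤ c + 3 ∧ (∀ k ≥ 4, μ' k = μ k) ∧
      G.Represents μ' (Function.update x i (addUnit (x i) r)) := by
  refine wp_assign_seq (by simp [address, RamExpr.Safe]) (by simp [entry, address, RamExpr.Safe])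
    (wp_assign trivial ⟨trivial, trivial⟩ ⟨le_rfl, fun k hk => ?_, ?_⟩)
  · rw [RamMem.write_of_ne _ _ _ (by omega), RamMem.write_of_ne _ _ _ (by omega)]
  · refine h.update (i := i) (r := r) (fun t ht => addUnit_of_ne _ ht) (by simp) (by simp) ?_ ?_
    · simp [RamExpr.val, entry, address, ha, hb, h.resources, h.profile]
    · simp [RamExpr.val, hb, hb2, h.load, load_eq x i, add_assoc]

theorem wp_remove {μ : RamMem} {c a b : ℕ} {x : Fin n → Fin m → ℕ} (h : G.Represents μ x)
    {i : Fin n} {r : Fin m} (ha : μ a 0 = i) (hb : μ b 0 = r) (hb2 : b ≠ 2) {z : Fin m → ℕ}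
    (hz : x i = addUnit z r) :
    (remove (var a) (var b)).Wp G μ c fun μ' c' => c' ≤ c + 3 ∧ (∀ k ≥ 4, μ' k = μ k) ∧
      G.Represents μ' (Function.update x i z) := by
  refine wp_assign_seq (by simp [address, RamExpr.Safe]) (by simp [entry, address, RamExpr.Safe])
    (wp_assign trivial ⟨trivial, trivial⟩ ⟨le_rfl, fun k hk => ?_, ?_⟩)
  · rw [RamMem.write_of_ne _ _ _ (by omega), RamMem.write_of_ne _ _ _ (by omega)]
  · refine h.update (i := i) (r := r) (fun t ht => by rw [hz, addUnit_of_ne _ ht]) (by simp)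
      (by simp) ?_ ?_
    · simp [RamExpr.val, entry, address, ha, hb, h.resources, h.profile, hz]
    · simp [RamExpr.val, hb, hb2, h.load, load_eq x i, hz]

/-- The situation in the while-loop of the algorithm: the first `J` players cannot improve. The
number `k` bounds the number of the remaining steps. -/
def InPhase (G : PolymatroidGame (Fin n) (Fin m)) (e : Fin n → ℕ) (k : ℕ) (μ : RamMem) : Prop :=
  ∃ (T : ℕ) (s : AlgState (Fin n) (Fin m)) (r : Fin m) (J : ℕ), G.AlgRun T s ∧ s.demand = e ∧
    G.Marked s r ∧ G.Represents μ s.profile ∧ μ 8 0 = r ∧ μ 6 0 = J ∧ J ≤ n ∧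
    (∀ j : Fin n, (j : ℕ) < J → ¬ G.CanImprove s.demand s.profile j) ∧
    -- Each remaining iteration weighs `n`, since after a move the scan restarts at player `0`.
    k = n * (iterBound n m G.maxDemand - T) + (n - J)

theorem algRun_le_iterBound (hn : 0 < n) (hm : 0 < m) {s : AlgState (Fin n) (Fin m)} {T : ℕ}
    (h : G.AlgRun T s) : T ≤ iterBound n m G.maxDemand := by
  have : Nonempty (Fin n) := ⟨⟨0, hn⟩⟩
  have : Nonempty (Fin m) := ⟨⟨0, hm⟩⟩
  refine h.le_sum_mul.trans ((Nat.mul_le_mul sum_demand_le phaseBound_le).trans ?_)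
  simp [iterBound]

theorem wp_improveStep (hn : 0 < n) (hm : 0 < m) {μ : RamMem} {c k : ℕ} {e : Fin n → ℕ}
    (h : InPhase G e k μ) (hJ : μ 6 0 < n) :
    improveStep.Wp G μ c fun μ' c' => (∃ k' < k, InPhase G e k' μ') ∧
      c' ≤ c + (findBound m G.maxDemand (2 ^ G.maxDemand) + 40) := by
  obtain ⟨T, s, r, J, hrun, rfl, hM, hrep, h8, h6, -, hJimp, rfl⟩ := h
  rw [h6] at hJ
  set i : Fin n := ⟨J, hJ⟩ with hi
  have h6' : μ 6 0 = i := h6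
  have hfeas := hrun.inv.1
  have hcell : (entry (var 6) (var 8)).val G μ = s.profile i r := by
    simp [entry, address, RamExpr.val, h6', h8, hrep.resources, hrep.profile]
  have hdec : n * (iterBound n m G.maxDemand - T) + (n - (J + 1)) <
      n * (iterBound n m G.maxDemand - T) + (n - J) := by omega
  have hstay : ¬ G.CanImprove s.demand s.profile i →
      ∀ j : Fin n, (j : ℕ) < J + 1 → ¬ G.CanImprove s.demand s.profile j := by
    intro hc j hj
    rcases Nat.lt_succ_iff_lt_or_eq.1 hj with hj | hj
    · exact hJimp j hj
    · obtain rfl : j = i := Fin.ext hj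
      exact hc
  refine wp_ite (by simp [entry, address, RamExpr.Safe]) (fun hne => ?_) (fun he => ?_)
  · rw [hcell] at hne
    obtain ⟨z, hz⟩ := exists_eq_addUnit (x := s.profile i) (p := r) (by omega)
    refine wp_seq ((wp_remove hrep h6' h8 (by decide) hz).mono ?_)
    rintro ν c1 - ⟨hc1, hfr1, hrep1⟩
    refine wp_assign_seq trivial trivial (wp_seq ?_)
    simp only [RamExpr.val, hfr1 6 (by decide), h6']
    have hbase := hfeas.base i
    have hzsum : ∑ t, z t + 1 = s.demand i := by
      rw [← hbase.2, hz, univ_sum_addUnit]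
    have hprof : Function.update s.profile i z i = z := Function.update_self _ _ _
    have hle : ∀ j, ∑ t, Function.update s.profile i z j t ≤ G.demand j := by
      intro j
      by_cases hj : j = i
      · rw [hj, hprof]
        have := hfeas.le i
        omega
      · rw [Function.update_of_ne hj, (hfeas.base j).2]
        exact hfeas.le j
    have hrep2 : G.Represents (ν.write 7 0 i) (Function.update s.profile i z) :=
      hrep1.congr fun a ha => RamMem.write_of_ne _ _ _ (by omega)
    refine (wp_findBest hrep2 (i := i) hle (by simp) (d := s.demand i) (by rw [hprof, hzsum])
      (hfeas.le i) ⟨r, by rw [hprof, ← hz]; exact hbase⟩).mono ?_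
    rintro ξ c2 - ⟨hc2, hfr2, t, h10, htb, hmin⟩
    rw [hprof] at htb
    simp only [hprof, load_update] at hmin
    have hmin' : ∀ q, addUnit z q ∈ (G.f i).base (s.demand i) →
        G.inc i t (others s.profile i t + z t) (z t) ≤
          G.inc i q (others s.profile i q + z q) (z q) := by
      intro q hq
      rw [← coe_natInc, ← coe_natInc]
      exact_mod_cast hmin q hq
    have f6 : ξ 6 0 = i := by rw [hfr2 6 (by decide)]; simp [hfr1 6, h6']
    have f7 : ξ 7 0 = i := by rw [hfr2 7 (by decide)]; simp
    have f8 : ξ 8 0 = r := by rw [hfr2 8 (by decide)]; simp [hfr1 8, h8]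
    have hrep3 : G.Represents ξ (Function.update s.profile i z) :=
      hrep2.congr fun a ha => hfr2 a (by omega)
    have hsi : ∑ t, Function.update s.profile i z i t + 1 ≤ G.demand i := by
      rw [hprof, hzsum]
      exact hfeas.le i
    have s1 := increase_spec hrep3 hle hsi f7 f8
    have s2 := increase_spec hrep3 hle hsi f7 h10
    rw [load_update, hprof] at s1 s2
    refine wp_ite ⟨s1.1, s2.1⟩ (fun hlt => ?_) (fun hge => ?_)
    · rw [RamExpr.val, s1.2, s2.2] at hlt
      have hlt' : G.inc i t (others s.profile i t + z t) (z t) <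
          G.inc i r (others s.profile i r + z r) (z r) := by
        rw [← coe_natInc, ← coe_natInc]
        exact_mod_cast Nat.lt_of_sub_ne_zero hlt
      obtain ⟨hstep, hM'⟩ := hM.algStep_move hfeas hz htb hmin' hlt'
      refine wp_seq ((wp_place hrep3 f6 h10 (by decide)).mono ?_)
      rintro ρ c3 - ⟨hc3, hfr3, hrep4⟩
      rw [hprof, Function.update_idem] at hrep4
      refine wp_assign_seq trivial trivial (wp_assign trivial trivial ⟨⟨_, ?_, T + 1, _, t, 0,
        .step hrun hstep, rfl, hM', hrep4.congr fun a ha => ?_, ?_, ?_, Nat.zero_le _,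
        fun j hj => absurd hj (Nat.not_lt_zero _), rfl⟩, by omega⟩)
      -- The iteration releases `n`, which pays for the restart; `n - J > 0` makes the decrease
      -- strict. That the new run also obeys the bound keeps the truncated subtraction exact.
      · have h1 := algRun_le_iterBound hn hm (.step hrun hstep)
        obtain ⟨w, hw⟩ : ∃ w, iterBound n m G.maxDemand = T + 1 + w := ⟨_, (by omega :
          iterBound n m G.maxDemand = T + 1 + (iterBound n m G.maxDemand - (T + 1)))⟩
        have e1 : T + 1 + w - (T + 1) = w := by omega
        have e2 : T + 1 + w - T = w + 1 := by omega
        rw [hw, e1, e2, Nat.mul_succ]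
        omega
      · rw [RamMem.write_of_ne _ _ _ (by omega), RamMem.write_of_ne _ _ _ (by omega)]
      · simp [RamExpr.val, hfr3 10, h10]
      · simp [RamExpr.val]
    · rw [RamExpr.val, s1.2, s2.2] at hge
      -- Even a cheapest target is no cheaper than `r`, and only moves off the marked resource could
      -- help.
      have hcan : ¬ G.CanImprove s.demand s.profile i := by
        refine hM.not_canImprove hfeas fun z' hz' q hq => ?_
        obtain rfl : z = z' := addUnit_injective (hz.symm.trans hz')
        refine le_trans ?_ (hmin' q hq)
        rw [← coe_natInc, ← coe_natInc]
        exact_mod_cast Nat.sub_eq_zero_iff_le.1 hge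
      refine wp_seq ((wp_place hrep3 f6 f8 (by decide)).mono ?_)
      rintro ρ c3 - ⟨hc3, hfr3, hrep4⟩
      rw [hprof, Function.update_idem, ← hz, Function.update_eq_self] at hrep4
      refine wp_assign trivial ⟨trivial, trivial⟩ ⟨⟨_, hdec, T, s, r, J + 1, hrun, rfl, hM,
        hrep4.congr fun a ha => ?_, ?_, ?_, hJ, hstay hcan, rfl⟩, by omega⟩
      · rw [RamMem.write_of_ne _ _ _ (by omega)]
      · simp [hfr3 8, f8]
      · simp [RamExpr.val, hfr3 6, f6, hi]
  · rw [hcell] at he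
    have hcan : ¬ G.CanImprove s.demand s.profile i := by
      refine hM.not_canImprove hfeas fun z hz => ?_
      rw [hz, addUnit_self] at he
      omega
    refine wp_assign trivial ⟨trivial, trivial⟩ ⟨⟨_, hdec, T, s, r, J + 1, hrun, rfl, hM,
      hrep.congr fun a ha => ?_, ?_, ?_, hJ, hstay hcan, rfl⟩, by omega⟩
    · rw [RamMem.write_of_ne _ _ _ (by omega)]
    · simp [h8]
    · simp [RamExpr.val, h6]

/-- Between two iterations of the for-loop, the algorithm is at an equilibrium for the preliminary
demands `e`. -/
def AtEquilibrium (G : PolymatroidGame (Fin n) (Fin m)) (e : Fin n → ℕ) (μ : RamMem) : Prop :=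
  ∃ (T : ℕ) (s : AlgState (Fin n) (Fin m)), G.AlgRun T s ∧ s.demand = e ∧
    G.Represents μ s.profile ∧ ∀ j, ¬ G.CanImprove s.demand s.profile j

theorem AtEquilibrium.congr {e : Fin n → ℕ} {μ ν : RamMem} (h : AtEquilibrium G e μ)
    (hν : ∀ a < 4, ν a = μ a) : AtEquilibrium G e ν := by
  obtain ⟨T, s, h1, h2, h3, h4⟩ := h
  exact ⟨T, s, h1, h2, h3.congr hν, h4⟩

theorem wp_addStep (hn : 0 < n) (hm : 0 < m) {μ : RamMem} {c : ℕ} {e : Fin n → ℕ}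
    (h : AtEquilibrium G e μ) {i : Fin n} (h4 : μ 4 0 = i) (hi : e i < G.demand i) :
    addStep.Wp G μ c fun μ' c' => AtEquilibrium G (Function.update e i (e i + 1)) μ' ∧
      c' ≤ c + addBound n m G.maxDemand (2 ^ G.maxDemand) := by
  obtain ⟨T, s, hrun, rfl, hrep, hopt⟩ := h
  have hfeas := hrun.inv.1
  have hle : ∀ j, ∑ t, s.profile j t ≤ G.demand j := fun j => by
    rw [(hfeas.base j).2]
    exact hfeas.le j
  refine wp_assign_seq trivial trivial (wp_seq ?_)
  simp only [RamExpr.val, h4]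
  have hrep1 : G.Represents (μ.write 7 0 i) s.profile :=
    hrep.congr fun a ha => RamMem.write_of_ne _ _ _ (by omega)
  refine (wp_findBest hrep1 (i := i) hle (by simp) (d := s.demand i + 1)
    (by rw [(hfeas.base i).2]) hi
    (exists_augment (hfeas.base i) (hi.trans_le (G.demand_le i)))).mono ?_
  rintro ν c1 - ⟨hc1, hfr1, t, h10, htb, hmin⟩
  have hmin' : ∀ q, addUnit (s.profile i) q ∈ (G.f i).base (s.demand i + 1) →
      G.inc i t (others s.profile i t + s.profile i t) (s.profile i t) ≤
        G.inc i q (others s.profile i q + s.profile i q) (s.profile i q) := by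
    intro q hq
    rw [← coe_natInc, ← coe_natInc, ← load_eq, ← load_eq]
    exact_mod_cast hmin q hq
  obtain ⟨hstep, hM⟩ := algStep_insert hfeas hopt hi htb hmin'
  have hrep2 : G.Represents ν s.profile := hrep1.congr fun a ha => hfr1 a (by omega)
  have f4 : ν 4 0 = i := by rw [hfr1 4 (by decide)]; simp [h4]
  refine wp_seq ((wp_place hrep2 f4 h10 (by decide)).mono ?_)
  rintro ξ c2 - ⟨hc2, hfr2, hrep3⟩
  refine wp_assign_seq trivial trivial (wp_assign_seq trivial trivial ?_)
  refine wp_loop (InPhase G (Function.update s.demand i (s.demand i + 1)))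
    (findBound m G.maxDemand (2 ^ G.maxDemand) + 40) ?_ ?_
    (k := n * (iterBound n m G.maxDemand - (T + 1)) + n) ?_ ?_
  · exact fun _ _ _ => ⟨trivial, trivial⟩
  · intro k ρ c hρ hne
    refine wp_improveStep hn hm hρ ?_
    obtain ⟨_, _, _, _, -, -, -, hr, -⟩ := hρ
    simp only [RamExpr.val, hr.players] at hne
    omega
  · refine ⟨T + 1, _, t, 0, .step hrun hstep, rfl, hM, hrep3.congr fun a ha => ?_, ?_, ?_,
      Nat.zero_le _, fun j hj => absurd hj (Nat.not_lt_zero _), rfl⟩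
    · rw [RamMem.write_of_ne _ _ _ (by omega), RamMem.write_of_ne _ _ _ (by omega)]
    · simp [RamExpr.val, hfr2 10, h10]
    · simp [RamExpr.val]
  -- The loop ends with `J = n`: everybody has been checked since the last move.
  · rintro k ρ c3 ⟨T', s', r', J, hrun', hdem, -, hrep', -, h6, -, himp, -⟩ he hc3
    simp only [RamExpr.val, hrep'.players, h6] at he
    refine ⟨⟨T', s', hrun', hdem, hrep', fun j => himp j (by have := j.2; omega)⟩, ?_⟩
    have e1 : (n * (iterBound n m G.maxDemand - (T + 1)) + n) *
        (findBound m G.maxDemand (2 ^ G.maxDemand) + 40 + 1) ≤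
        (n * iterBound n m G.maxDemand + n) * (findBound m G.maxDemand (2 ^ G.maxDemand) + 41) := by
      gcongr
      omega
    unfold addBound
    omega

/-- The demands after `K` iterations of the inner loop for player `I`. -/
def partialDemand (G : PolymatroidGame (Fin n) (Fin m)) (I K : ℕ) (j : Fin n) : ℕ :=
  if (j : ℕ) < I then G.demand j else if (j : ℕ) = I then K else 0

theorem partialDemand_succ (i : Fin n) (K : ℕ) :
    partialDemand G i (K + 1) =
      Function.update (partialDemand G i K) i (partialDemand G i K i + 1) := by
  ext j
  by_cases hj : j = i
  · subst hj
    simp [partialDemand]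
  · have : (j : ℕ) ≠ i := fun h => hj (Fin.ext h)
    simp [partialDemand, hj, this]

theorem partialDemand_next (i : Fin n) :
    partialDemand G (i + 1) 0 = partialDemand G i (G.demand i) := by
  ext j
  by_cases hj : j = i
  · subst hj
    simp [partialDemand]
  · have : (j : ℕ) ≠ i := fun h => hj (Fin.ext h)
    simp only [partialDemand, this, if_false, ite_self]
    congr 1
    simp only [eq_iff_iff]
    omega

theorem wp_computeNash (hn : 0 < n) (hm : 0 < m) {c : ℕ} :
    computeNash.Wp G (ramInput G) c fun μ' c' =>
      c' ≤ c + nashBound n m G.maxDemand (2 ^ G.maxDemand) ∧ G.IsPureNash (ramOutput n m μ') := by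
  -- The units of demand are handed out player by player, which is one admissible order of the free
  -- choices.
  refine wp_forLoop (fun I ν => AtEquilibrium G (partialDemand G I 0) ν) n
    (G.maxDemand * (addBound n m G.maxDemand (2 ^ G.maxDemand) + 3) + 3) ?_ ?_ ?_ ?_
  · rintro k ν ⟨_, _, -, -, hr, -⟩
    exact ⟨trivial, by simp [RamExpr.val, hr.players]⟩
  · intro I ν c hI hν h4
    set i : Fin n := ⟨I, hI⟩ with hi
    refine wp_forLoop (fun K ξ => AtEquilibrium G (partialDemand G i K) ξ ∧ ξ 4 0 = i)
      (G.demand i) (addBound n m G.maxDemand (2 ^ G.maxDemand)) ?_ ?_ ?_ ?_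
    · rintro K ξ ⟨⟨_, _, -, -, hr, -⟩, h4'⟩
      exact ⟨trivial, by simp [RamExpr.val, h4', hr.demand]⟩
    · rintro K ξ c hK ⟨hξ, h4'⟩ h5
      refine (wp_addStep hn hm hξ h4' (by simpa [partialDemand] using hK)).mono ?_
      rintro ξ' c' hf ⟨h1, h2⟩
      have f4 : ξ' 4 = ξ 4 := hf 4 (by decide)
      have f5 : ξ' 5 = ξ 5 := hf 5 (by decide)
      refine ⟨⟨by rw [f5, h5], ?_, by simpa [f4] using h4'⟩, h2⟩
      rw [partialDemand_succ]
      exact h1.congr fun a ha => RamMem.write_of_ne _ _ _ (by omega)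
    · exact ⟨hν.congr fun a ha => RamMem.write_of_ne _ _ _ (by omega), by simpa using h4⟩
    · rintro ξ c' ⟨h1, h2⟩ - hc'
      have hd : G.demand i ≤ G.maxDemand := Finset.le_sup (f := G.demand) (Finset.mem_univ i)
      have h3 := Nat.mul_le_mul_right (addBound n m G.maxDemand (2 ^ G.maxDemand) + 3) hd
      refine ⟨⟨h2, ?_⟩, by omega⟩
      have h5 := partialDemand_next (G := G) i
      rw [show I + 1 = (i : ℕ) + 1 from rfl, h5]
      exact h1.congr fun a ha => RamMem.write_of_ne _ _ _ (by omega)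
  · refine AtEquilibrium.congr (μ := ramInput G) ?_
      fun a ha => RamMem.write_of_ne _ _ _ (by omega)
    refine ⟨0, AlgState.init _ _, .start, ?_, ?_, not_canImprove_init⟩
    · ext j
      simp [AlgState.init, partialDemand]
    · constructor <;> simp [ramInput, AlgState.init]
  · rintro ν c' ⟨T, s, hrun, hdem, hrep, hopt⟩ - hc'
    refine ⟨?_, ?_⟩
    · unfold nashBound
      simp only [Nat.add_assoc, Nat.reduceAdd] at *
      omega
    · have h1 := isPureNash_of_returns hrun.inv.1 hopt (by
        rw [hdem]
        ext j
        simp [partialDemand])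
      have h2 : ramOutput n m ν = s.profile := by
        ext i r
        exact hrep.profile i r
      rwa [h2]

theorem bounded_ramInput : (ramInput G).Bounded (n + m + G.maxBits) := by
  have h1 : n + m < 2 ^ (n + m + G.maxBits) :=
    Nat.lt_two_pow_self.trans_le (two_pow_le (Nat.le_add_right _ _))
  intro a j
  unfold ramInput
  split_ifs with h0 h2 h3 h4 h5
  · omega
  · omega
  · positivity
  -- A demand is at most the rank of the ground set, whose bit length is counted in `maxBits`.
  · refine (G.demand_le _).trans_lt ?_
    have h6 := rankOracle_lt G j fun _ => 1
    simp only [rankOracle, h5, dif_pos, ne_eq, one_ne_zero, not_false_eq_true,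
      Finset.filter_true] at h6
    exact h6.trans_le (two_pow_le (by omega))
  · positivity
  · positivity

end

theorem nashBound_mono {n m D E n' m' D' E' : ℕ} (hn : n ≤ n') (hm : m ≤ m') (hD : D ≤ D')
    (hE : E ≤ E') : nashBound n m D E ≤ nashBound n' m' D' E' := by
  unfold nashBound addBound iterBound findBound checkBound
  gcongr

/-- A pure Nash equilibrium can be computed in polynomial time when the demands are bounded. -/
theorem exists_polynomial (δ : ℕ) : ∃ P : Polynomial ℕ, ∀ n m : ℕ, 0 < n → 0 < m →
    ∀ G : PolymatroidGame (Fin n) (Fin m), G.maxDemand ≤ δ →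
      ∃ (t : ℕ) (μ : RamMem), RamExec G computeNash (ramInput G) t μ ∧
        t ≤ P.eval (n + m + G.maxBits) ∧ G.IsPureNash (ramOutput n m μ) := by
  generalize hW : computeNash.weight = W
  -- The bounds are stated over any commutative semiring, so the same expression is a polynomial
  -- here. Both `n` and `m` are replaced by the variable, while `δ` and `2 ^ δ` are constants.
  let S : Polynomial ℕ := nashBound Polynomial.X Polynomial.X (δ : Polynomial ℕ)
    ((2 ^ δ : ℕ) : Polynomial ℕ)
  refine ⟨S * ((W : Polynomial ℕ) * (1 + (Polynomial.X + S * (W : Polynomial ℕ)) * (W : Polynomial ℕ) +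
    Polynomial.X) + 1), ?_⟩
  intro n m hn hm G hG
  obtain ⟨s, μ, hrun, hs, hnash⟩ := wp_computeNash (G := G) hn hm (c := 0)
  obtain ⟨t, hexec, ht, -⟩ := hrun.exists_exec (C := n + m + G.maxBits + s * W)
    additive_computeNash hW.le (B := n + m + G.maxBits) (by omega) (by omega) bounded_ramInput le_rfl
  refine ⟨t, μ, hexec, ht.trans ?_, hnash⟩
  generalize hN : n + m + G.maxBits = N
  have hS : S.eval N = nashBound N N δ (2 ^ δ) := by
    simp [S, nashBound, addBound, iterBound, findBound, checkBound]
  have hsN : s ≤ nashBound N N δ (2 ^ δ) := by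
    refine le_trans (by simpa using hs) (nashBound_mono (by omega) (by omega) hG (two_pow_le hG))
  have hmN : m ≤ N := by omega
  simp only [Polynomial.eval_mul, Polynomial.eval_add, Polynomial.eval_X, Polynomial.eval_one,
    Polynomial.eval_natCast, hS, Nat.cast_id]
  gcongr

end RamProg

theorem mainTheorem2 :
    (∀ (N : Type*) (R : Type*) [Fintype N] [DecidableEq N] [Nonempty N]
      [Fintype R] [DecidableEq R] [Nonempty R] (G : PolymatroidGame N R),
      (∀ (T : ℕ) (s : PolymatroidGame.AlgState N R), G.AlgRun T s →
        T ≤ Fintype.card N ^ (G.maxDemand + 1) * Fintype.card R ^ G.maxDemand *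
          G.maxDemand ^ (G.maxDemand + 1)) ∧
      (∀ (T : ℕ) (s : PolymatroidGame.AlgState N R), G.AlgRun T s →
        (G.AlgReturns s ∧ G.IsPureNash s.profile) ∨
          (¬ G.AlgReturns s ∧ ∃ s', G.AlgStep s s'))) ∧
    (∃ prog : RamProg, ∀ δ : ℕ, ∃ P : Polynomial ℕ,
      ∀ (n m : ℕ), 0 < n → 0 < m → ∀ G : PolymatroidGame (Fin n) (Fin m), G.maxDemand ≤ δ →
        ∃ (t : ℕ) (μ : RamMem), RamExec G prog (ramInput G) t μ ∧
          t ≤ P.eval (n + m + G.maxBits) ∧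
          G.IsPureNash (ramOutput n m μ)) :=
  ⟨fun _ _ _ _ _ _ _ _ _ => ⟨fun _ _ h => h.le, fun _ _ h => h.progress⟩,
    RamProg.computeNash, RamProg.exists_polynomial⟩
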